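/- Let $\widetilde{\mathbb C^*}$ be the universal cover of $\mathbb C^*=\mathbb C\setminus\{0\}$; its points are $z=\rho e^{i\theta}$ with modulus $|z|=\rho>0$ and argument $\arg z=\theta\in\mathbb R$, and $\ln z=\ln\rho+i\theta$, $z^{\beta}=e^{\beta\ln z}$ for $\beta\in\mathbb R$. For $M>0$ put $\widetilde{\mathbb C}_M=\{z\in\widetilde{\mathbb C^*}: |z|>M\}$. Let $\Omega\subseteq\mathbb C$ be a domain (open, connected, non-empty), and consider the differential equation $$\frac{d\psi}{dz}=\bigl(-A\,p(z;\omega)+R(z;\omega)\bigr)\psi,\qquad \psi\in\mathbb C^n,\qquad(\ast)$$ where: * $A$ is a constant complex $n\times n$ matrix which is diagonalisable, with a basis of eigenvectors $\psi_1,\dots,\psi_n$ of $\mathbb C^n$ and corresponding eigenvalues $\nu_1,\dots,\nu_n$, not necessarily pairwise distinct; * $p(z;\omega)=z^{\beta_0}+\sum_{k=1}^{H}c_k(\omega)z^{\beta_k}$ with $H\ge 1$, real exponents $\beta_0>\beta_1>\dots>\beta_H=-1$, and coefficients $c_k$ that are bounded analytic functions on $\Omega$; put $$P(z;\omega)=\frac{z^{\beta_0+1}}{\beta_0+1}+\sum_{k=1}^{H-1}c_k(\omega)\frac{z^{\beta_k+1}}{\beta_k+1}+c_H(\omega)\ln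 z;$$ * $R$ is a holomorphic $n\times n$-matrix-valued function on $\widetilde{\mathbb C}_M\times\Omega$, and there is a fixed $\delta>0$ such that, in every closed sector $\alpha\le\arg z\le\alpha'$ ($\alpha,\alpha'\in\mathbb R$), $R(z;\omega)=O(z^{-1-\delta})$ as $z\to\infty$, uniformly in $\omega\in\Omega$. Then the following hold. 1. Let $a\le b$ be real numbers such that for all $\tau\in[a,b]$ and all $j,j'$ one has $\operatorname{Re}\bigl((\nu_j-\nu_{j'})e^{i\tau}\bigr)=0$ if and only if $\nu_j=\nu_{j'}$. Then there are functions $\psi_j(z;\omega)$, $j=1,\dots,n$, analytic on $\widetilde{\mathbb C}_M\times\Omega$, which for every $\omega\in\Omega$ form a basis of the space of solutions of $(\ast)$ on $\widetilde{\mathbb C}_M$, and such that $$\psi_j(z;\omega)=\bigl(\psi_j+O(z^{-\delta})\bigr)e^{-\nu_jP(z;\omega)}\quad\text{as } z\to\infty \text{ in the sector } \frac{a}{\beta_0+1}\le\arg z\le\frac{b+\pi}{\beta_0+1},$$ uniformly in $\omega\in\Omega$. They are unique: any family of functions on $\widetilde{\mathbb C}_M\times\Omega$ which solve $(\ast)$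 for every $\omega\in\Omega$ and have these asymptotics uniformly in $\omega\in\Omega$ coincides with $(\psi_j)_{j}$. 2. Let $a\le b$ be real numbers and let $j_0$ be a subdominant index for $[a,b]$, that is, $\operatorname{Re}\bigl((\nu_{j_0}-\nu_j)e^{i\tau}\bigr)>0$ for all $\tau\in[a,b]$ and all $j\ne j_0$. Then there is a unique function $\Psi(z;\omega)$ on $\widetilde{\mathbb C}_M\times\Omega$ which solves $(\ast)$ for every $\omega\in\Omega$ and satisfies $$\Psi(z;\omega)=\bigl(\psi_{j_0}+O(z^{-\delta})\bigr)e^{-\nu_{j_0}P(z;\omega)}\quad\text{as } z\to\infty \text{ in the sector } \frac{a-\pi}{\beta_0+1}\le\arg z\le\frac{b+\pi}{\beta_0+1},$$ uniformly in $\omega\in\Omega$. Moreover $\Psi$ is analytic on $\widetilde{\mathbb C}_M\times\Omega$. -/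

import Mathlib

open Filter Topology

/-! The universal cover of `ℂ \ {0}` is realised as `ℂ`, with the covering map `exp`: the point of
polar form `ρ e^{iθ}` (`ρ > 0`, `θ ∈ ℝ`) is represented by its logarithm `ζ = ln ρ + iθ`.  The maps
below express `z`, `|z|`, `arg z`, `ln z` and `z ^ β` at the point represented by `ζ`. -/

/-- A point of the universal cover of `ℂ \ {0}`, given by its logarithm. -/
abbrev PuncturedCover : Type := ℂ

namespace PuncturedCover

/-- The covering map onto `ℂ \ {0}`, i.e. the function `z`. -/
noncomputable def proj (ζ : PuncturedCover) : ℂ := Complex.exp ζ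

/-- The modulus `|z|`. -/
noncomputable def modulus (ζ : PuncturedCover) : ℝ := Real.exp ζ.re

/-- The (multivalued on `ℂ`, single-valued on the cover) argument `arg z`. -/
def argument (ζ : PuncturedCover) : ℝ := ζ.im

/-- The logarithm `ln z`. -/
def logarithm (ζ : PuncturedCover) : ℂ := ζ

/-- The power `z ^ β = exp (β ln z)` with real exponent. -/
noncomputable def power (ζ : PuncturedCover) (β : ℝ) : ℂ := Complex.exp (β * logarithm ζ)

theorem proj_eq_polar (ζ : PuncturedCover) :
    proj ζ = modulus ζ * Complex.exp (argument ζ * Complex.I) := by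
  simp only [proj, modulus, argument, Complex.ofReal_exp, ← Complex.exp_add, Complex.re_add_im]

/-- The part `|z| > M` of the universal cover. -/
def outer (M : ℝ) : Set PuncturedCover := {ζ | M < modulus ζ}

/-- `f` has derivative `f'` with respect to `z` at the point `ζ`: the difference quotient
`(f(w) - f(ζ)) / (z(w) - z(ζ))` tends to `f'` as `w → ζ` on the cover. -/
def HasZDerivAt {E : Type*} [NormedAddCommGroup E] [NormedSpace ℂ E]
    (f : PuncturedCover → E) (f' : E) (ζ : PuncturedCover) : Prop :=
  Tendsto (fun w => (proj w - proj ζ)⁻¹ • (f w - f ζ)) (𝓝[≠] ζ) (𝓝 f')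

/-- Chain rule: `df/dζ = z · df/dz` in the coordinate `ζ = ln z`. -/
theorem hasZDerivAt_iff {E : Type*} [NormedAddCommGroup E] [NormedSpace ℂ E]
    (f : PuncturedCover → E) (f' : E) (ζ : PuncturedCover) :
    HasZDerivAt f f' ζ ↔ HasDerivAt f (proj ζ • f') ζ := by
  have hexp : Tendsto (slope Complex.exp ζ) (𝓝[≠] ζ) (𝓝 (Complex.exp ζ)) :=
    hasDerivAt_iff_tendsto_slope.1 (Complex.hasDerivAt_exp ζ)
  have hne : Complex.exp ζ ≠ 0 := Complex.exp_ne_zero ζ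
  have hev : ∀ᶠ w in 𝓝[≠] ζ, slope Complex.exp ζ w ≠ 0 := hexp.eventually_ne hne
  have hev' : ∀ᶠ w in 𝓝[≠] ζ, w ≠ ζ := eventually_mem_nhdsWithin
  rw [hasDerivAt_iff_tendsto_slope]
  unfold HasZDerivAt proj
  constructor
  · intro h
    refine (hexp.smul h).congr' ?_
    filter_upwards [hev, hev'] with w hw hw'
    have h1 : w - ζ ≠ 0 := sub_ne_zero.2 hw'
    simp only [slope_def_module] at hw ⊢
    have h2 : Complex.exp w - Complex.exp ζ ≠ 0 := by
      intro h0
      exact hw (by simp [h0])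
    rw [smul_smul]
    congr 1
    simp only [smul_eq_mul]
    field_simp
  · intro h
    have h3 := (hexp.inv₀ hne).smul h
    rw [smul_smul, inv_mul_cancel₀ hne, one_smul] at h3
    refine h3.congr' ?_
    filter_upwards [hev, hev'] with w hw hw'
    have h1 : w - ζ ≠ 0 := sub_ne_zero.2 hw'
    simp only [slope_def_module] at hw ⊢
    have h2 : Complex.exp w - Complex.exp ζ ≠ 0 := by
      intro h0
      exact hw (by simp [h0])
    rw [smul_smul]
    congr 1
    simp only [smul_eq_mul]
    field_simp

/-- `f(z; ω) = O(z ^ s)` as `z → ∞` in the closed sector `α ≤ arg z ≤ α'`, uniformly in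
`ω ∈ Ω`. -/
def IsUniformBigO {E : Type*} [NormedAddCommGroup E] (Ω : Set ℂ) (α α' s : ℝ)
    (f : PuncturedCover → ℂ → E) : Prop :=
  ∃ C N : ℝ, ∀ ω ∈ Ω, ∀ ζ : PuncturedCover, N ≤ modulus ζ → α ≤ argument ζ → argument ζ ≤ α' →
    ‖f ζ ω‖ ≤ C * modulus ζ ^ s

/-- `f(z; ω)` is holomorphic (jointly in both variables) on `{|z| > M} × Ω`. -/
def IsHolomorphic {E : Type*} [NormedAddCommGroup E] [NormedSpace ℂ E] (M : ℝ) (Ω : Set ℂ)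
    (f : PuncturedCover → ℂ → E) : Prop :=
  DifferentiableOn ℂ (fun q : ℂ × ℂ => f q.1 q.2) (outer M ×ˢ Ω)

/-- `φ` solves the linear system `dφ/dz = B(z) φ` on `|z| > M`. -/
def IsSolution {n : ℕ} (M : ℝ) (B : PuncturedCover → Matrix (Fin n) (Fin n) ℂ)
    (φ : PuncturedCover → Fin n → ℂ) : Prop :=
  ∀ ζ ∈ outer M, HasZDerivAt φ ((B ζ).mulVec (φ ζ)) ζ

/-- The vector functions `Y j` form a basis of the solution space of `dφ/dz = B(z) φ` on
`|z| > M`: they are solutions, and every solution is a linear combination of them with unique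
constant coefficients. -/
def IsSolutionBasis {n : ℕ} (M : ℝ) (B : PuncturedCover → Matrix (Fin n) (Fin n) ℂ)
    (Y : Fin n → PuncturedCover → Fin n → ℂ) : Prop :=
  (∀ j, IsSolution M B (Y j)) ∧
    ∀ φ : PuncturedCover → Fin n → ℂ, IsSolution M B φ →
      ∃! x : Fin n → ℂ, ∀ ζ ∈ outer M, φ ζ = ∑ j, x j • Y j ζ

/-- `p(z; ω) = z ^ β₀ + ∑_{k=1}^H c_k(ω) z ^ β_k`. -/
noncomputable def leading (H : ℕ) (β : ℕ → ℝ) (c : ℕ → ℂ → ℂ) (ζ : PuncturedCover) (ω : ℂ) : ℂ :=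
  power ζ (β 0) + ∑ k ∈ Finset.Icc 1 H, c k ω * power ζ (β k)

/-- The primitive `P(z; ω) = z ^ (β₀ + 1) / (β₀ + 1)
+ ∑_{k=1}^{H-1} c_k(ω) z ^ (β_k + 1) / (β_k + 1) + c_H(ω) ln z`. -/
noncomputable def primitive (H : ℕ) (β : ℕ → ℝ) (c : ℕ → ℂ → ℂ) (ζ : PuncturedCover) (ω : ℂ) :
    ℂ :=
  power ζ (β 0 + 1) / ((β 0 + 1 : ℝ) : ℂ)
    + ∑ k ∈ Finset.Ico 1 H, c k ω * (power ζ (β k + 1) / ((β k + 1 : ℝ) : ℂ))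
    + c H ω * logarithm ζ

/-- The coefficient matrix `-A p(z; ω) + R(z; ω)` at a fixed parameter `ω`. -/
noncomputable def coefficient {n : ℕ} (A : Matrix (Fin n) (Fin n) ℂ) (H : ℕ) (β : ℕ → ℝ)
    (c : ℕ → ℂ → ℂ) (R : PuncturedCover → ℂ → Matrix (Fin n) (Fin n) ℂ) (ω : ℂ) :
    PuncturedCover → Matrix (Fin n) (Fin n) ℂ :=
  fun ζ => -(leading H β c ζ ω • A) + R ζ ω

/-- `ψ(z; ω) = (v + O(z ^ (-δ))) e ^ (-g(z; ω))` as `z → ∞` in the closed sector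
`α ≤ arg z ≤ α'`, uniformly in `ω ∈ Ω`. -/
def HasAsymptotics {n : ℕ} (M : ℝ) (Ω : Set ℂ) (α α' δ : ℝ) (v : Fin n → ℂ)
    (g : PuncturedCover → ℂ → ℂ) (ψ : PuncturedCover → ℂ → Fin n → ℂ) : Prop :=
  ∃ ε : PuncturedCover → ℂ → Fin n → ℂ, IsUniformBigO Ω α α' (-δ) ε ∧
    ∀ ζ ∈ outer M, ∀ ω ∈ Ω, ψ ζ ω = Complex.exp (-g ζ ω) • (v + ε ζ ω)

end PuncturedCover

/-! Write κ = β₀ + 1 and use the coordinate ζ = ln z, in which |z| > M is a half-plane. In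
coordinates along the eigenbasis the equation becomes x_k' = -ν_k q x_k + e^ζ (R x)_k, where q = z p
is the ζ-derivative of P and q ~ e^{κζ} uniformly in ω. Multiplying by exp(ν_j P) replaces -ν_k by
l_k = ν_j - ν_k. The j-th basis vector is then annihilated by the diagonal part, and a solution
tending to it is wanted.

Existence on one sector: put u = z^κ e^{-iθ} with θ = σ + π/2, so that the sector σ ≤ κ arg z ≤ σ +
π becomes Re u ≥ 0. The Volterra equation is solved by integrating the k-th component from infinity
along rays of direction ε + i or ε - i, the sign being chosen so that Re(l_k e^{iθ} d_k) > 0 unless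
l_k = 0. The exponential kernel then has modulus at most 1, while the remainder is O(|u|^{-1-δ/κ})
and hence integrable. All these rays stay in one domain, the exterior of a blunt wedge, which
contains the far part of the closed half-plane Re u ≥ 0. A Neumann series converges there
(`exists_ray_solution`, `exists_wedge_solution`), and linear continuation extends its sum to all of
|z| > M (`exists_sectorial_solution`).

Wider sectors come from gluing. Solutions built from different σ coincide because their difference
is small compared with the leading exponential along suitable common rays. If that exponential is
subdominant on a ray, an energy estimate shows that the difference vanishes
(`IsReducedSolution.eq_zero_of_tendsto_ray`). For whole families, each coefficient of the difference
in the solution basis is killed on one of two rays (`eq_of_two_rays`): the sign of Re((ν_j - ν_k)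
e^{iτ}) is constant on [a, b] and is reversed when π is added to τ. The same comparisons give
uniqueness in the theorem. -/

/-! ### Holomorphy of integrals and series depending on parameters. -/

section HolomorphicFamilies

open MeasureTheory Metric

/-- An integral of holomorphic functions with a locally uniform integrable bound is holomorphic. -/
theorem differentiableAt_integral_of_dominated {α E : Type*} [MeasurableSpace α] {μ : Measure α}
    [NormedAddCommGroup E] [NormedSpace ℂ E]
    {F : ℂ × ℂ → α → E} {x₀ : ℂ × ℂ} {r : ℝ} {bound : α → ℝ} (hr : 0 < r)
    (hF_meas : ∀ x ∈ ball x₀ r, AEStronglyMeasurable (F x) μ)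
    (hbound : Integrable bound μ)
    (hF_le : ∀ᵐ a ∂μ, ∀ x ∈ ball x₀ r, ‖F x a‖ ≤ bound a)
    (hF_diff : ∀ᵐ a ∂μ, DifferentiableOn ℂ (fun x => F x a) (ball x₀ r)) :
    DifferentiableAt ℂ (fun x => ∫ a, F x a ∂μ) x₀ := by
  have hx₀ : x₀ ∈ ball x₀ r := mem_ball_self hr
  have hdiff : ∀ᵐ a ∂μ, HasFDerivAt (F · a) (fderiv ℂ (F · a) x₀) x₀ := by
    filter_upwards [hF_diff] with a ha
    exact (ha.differentiableAt (isOpen_ball.mem_nhds hx₀)).hasFDerivAt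
  -- A directional derivative is measurable in `a` as a limit of difference quotients with
  -- increments v/(m + 1). Starting at `m₀` keeps the displaced points in the ball, where
  -- measurability is known.
  have hdir : ∀ v : ℂ × ℂ, AEStronglyMeasurable (fun a => fderiv ℂ (F · a) x₀ v) μ := by
    intro v
    have hc : Tendsto (fun m : ℕ => ‖((m : ℂ) + 1)‖) atTop atTop := by
      have h2 : Tendsto (fun m : ℕ => (m : ℝ) + 1) atTop atTop :=
        tendsto_atTop_add_const_right _ _ tendsto_natCast_atTop_atTop
      refine h2.congr fun m => ?_
      have : ((m : ℂ) + 1) = (((m : ℝ) + 1 : ℝ) : ℂ) := by push_cast; ring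
      rw [this, Complex.norm_real, Real.norm_of_nonneg (by positivity)]
    have ht : Tendsto (fun m : ℕ => ((m : ℂ) + 1)⁻¹ • v) atTop (𝓝 0) := by
      have := (tendsto_inv₀_cobounded.comp (tendsto_norm_atTop_iff_cobounded.1 hc)).smul_const v
      simpa using this
    obtain ⟨m₀, hm₀⟩ := eventually_atTop.1 (ht.eventually (ball_mem_nhds (0 : ℂ × ℂ) hr))
    have hadd : Tendsto (fun m : ℕ => m + m₀) atTop atTop := tendsto_add_atTop_nat m₀
    refine aestronglyMeasurable_of_tendsto_ae (u := atTop)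
      (f := fun m a => (((m + m₀ : ℕ) : ℂ) + 1) •
        (F (x₀ + (((m + m₀ : ℕ) : ℂ) + 1)⁻¹ • v) a - F x₀ a)) ?_ ?_
    · intro m
      refine ((hF_meas _ ?_).sub (hF_meas _ hx₀)).const_smul _
      have := hm₀ (m + m₀) (Nat.le_add_left _ _)
      simpa [mem_ball, dist_eq_norm] using this
    · filter_upwards [hdiff] with a ha
      exact ha.lim v (hc.comp hadd)
  have hmeas : AEStronglyMeasurable (fun a => fderiv ℂ (F · a) x₀) μ := by
    have h1 := (ContinuousLinearMap.smulRightL ℂ (ℂ × ℂ) E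
      (ContinuousLinearMap.fst ℂ ℂ ℂ)).continuous.comp_aestronglyMeasurable (hdir (1, 0))
    have h2 := (ContinuousLinearMap.smulRightL ℂ (ℂ × ℂ) E
      (ContinuousLinearMap.snd ℂ ℂ ℂ)).continuous.comp_aestronglyMeasurable (hdir (0, 1))
    refine (h1.add h2).congr (Eventually.of_forall fun a => ?_)
    ext <;> simp
  -- The Lipschitz constant comes from the Schwarz lemma: on the ball of radius r the values stay
  -- within twice the bound of the value at the centre.
  refine (hasFDerivAt_integral_of_dominated_loc_of_lip' (𝕜 := ℂ) (F' := fun a => fderiv ℂ (F · a) x₀)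
    (bound := fun a => 2 * bound a / r)
    (ball_mem_nhds x₀ hr) hF_meas ?_ hmeas ?_ ((hbound.const_mul 2).div_const r)
    hdiff).2.differentiableAt
  · exact hbound.mono' (hF_meas x₀ hx₀) (hF_le.mono fun a ha => ha x₀ hx₀)
  · filter_upwards [hF_diff, hF_le] with a hd hle x hx
    rw [← dist_eq_norm, ← dist_eq_norm]
    refine Complex.dist_le_div_mul_dist_of_mapsTo_ball (f := fun x => F x a) hd (fun y hy => ?_) hx
    rw [mem_closedBall, dist_eq_norm]
    have := norm_sub_le (F y a) (F x₀ a)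
    linarith [hle y hy, hle x₀ hx₀]

/-- A normally convergent series of holomorphic functions is holomorphic. -/
theorem differentiableAt_tsum_of_summable_norm_of_ball {H E : Type*} [NormedAddCommGroup H]
    [NormedSpace ℂ H] [NormedAddCommGroup E] [NormedSpace ℂ E] [CompleteSpace E]
    {f : ℕ → H → E} {x₀ : H} {r : ℝ} {u : ℕ → ℝ} (hr : 0 < r) (hu : Summable u)
    (hf : ∀ m, DifferentiableOn ℂ (f m) (ball x₀ r))
    (hle : ∀ m, ∀ x ∈ ball x₀ r, ‖f m x‖ ≤ u m) :
    DifferentiableAt ℂ (fun x => ∑' m, f m x) x₀ := by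
  let : NormedSpace ℝ H := NormedSpace.restrictScalars ℝ ℂ H
  -- Halving the radius leaves room for a Cauchy estimate of the derivatives, uniform over the
  -- smaller ball.
  have hsub : ∀ x ∈ ball x₀ (r / 2), ball x (r / 2) ⊆ ball x₀ r := fun x hx =>
    ball_subset_ball' (by rw [mem_ball] at hx; linarith)
  have hx₀ : x₀ ∈ ball x₀ (r / 2) := mem_ball_self (half_pos hr)
  refine (hasFDerivAt_tsum_of_isPreconnected (𝕜 := ℂ) (u := fun m => 2 * u m / (r / 2))
    (f := f) (f' := fun m x => fderiv ℂ (f m) x) ((hu.mul_left 2).div_const _)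
    (isOpen_ball (x := x₀) (ε := r / 2)) (convex_ball x₀ (r / 2)).isPreconnected ?_ ?_ hx₀
    (Summable.of_norm_bounded hu fun m => hle m x₀ (mem_ball_self hr)) hx₀).differentiableAt
  · intro m x hx
    exact ((hf m).differentiableAt (isOpen_ball.mem_nhds
      (hsub x hx (mem_ball_self (half_pos hr))))).hasFDerivAt
  · intro m x hx
    refine Complex.norm_fderiv_le_div_of_mapsTo_ball ((hf m).mono (hsub x hx)) (fun y hy => ?_)
      (half_pos hr)
    rw [mem_closedBall, dist_eq_norm]
    have := norm_sub_le (f m y) (f m x)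
    linarith [hle m y (hsub x hx hy), hle m x (hsub x hx (mem_ball_self (half_pos hr)))]

end HolomorphicFamilies

/-! ### Uniqueness for linear equations, by Grönwall along segments. -/

section LinearODE

open MeasureTheory Metric

variable {E : Type*} [NormedAddCommGroup E] [NormedSpace ℂ E]

/-- A solution of a linear differential equation on a convex set which vanishes at one point
vanishes identically. -/
theorem eq_zero_of_linear_ode {U : Set ℂ} (hU : Convex ℝ U) {B : ℂ → E →L[ℂ] E}
    (hB : ContinuousOn B U) {x : ℂ → E} (hx : ∀ ζ ∈ U, HasDerivAt x (B ζ (x ζ)) ζ)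
    {ζ₀ : ℂ} (hζ₀ : ζ₀ ∈ U) (h0 : x ζ₀ = 0) {ζ : ℂ} (hζ : ζ ∈ U) : x ζ = 0 := by
  set γ : ℝ → ℂ := fun t => ζ₀ + (t : ℂ) * (ζ - ζ₀) with hγ
  have hγU : ∀ t ∈ Set.Icc (0 : ℝ) 1, γ t ∈ U := by
    intro t ht
    have := hU.add_smul_sub_mem hζ₀ hζ ht
    simpa [hγ] using this
  have hγc : Continuous γ := by fun_prop
  have hγd : ∀ t, HasDerivAt γ (ζ - ζ₀) t := by
    intro t
    have h1 : HasDerivAt (fun t : ℝ => (t : ℂ)) 1 t := Complex.ofRealCLM.hasDerivAt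
    simpa [hγ] using (h1.mul_const (ζ - ζ₀)).const_add ζ₀
  obtain ⟨K, hK⟩ := (isCompact_Icc (a := (0 : ℝ)) (b := 1)).exists_bound_of_continuousOn
    (hB.comp hγc.continuousOn hγU)
  have hd : ∀ t ∈ Set.Icc (0 : ℝ) 1,
      HasDerivAt (fun t => x (γ t)) ((ζ - ζ₀) • B (γ t) (x (γ t))) t := fun t ht =>
    (hx _ (hγU t ht)).scomp t (hγd t)
  have := eq_zero_of_abs_deriv_le_mul_abs_self_of_eq_zero_right (f := fun t => x (γ t))
    (f' := fun t => (ζ - ζ₀) • B (γ t) (x (γ t))) (K := ‖ζ - ζ₀‖ * K) (a := 0) (b := 1)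
    (fun t ht => (hd t ht).continuousAt.continuousWithinAt)
    (fun t ht => (hd t ⟨ht.1, ht.2.le⟩).hasDerivWithinAt) (by simpa [hγ] using h0)
    (fun t ht => by
      rw [norm_smul, mul_assoc]
      gcongr
      exact ((B (γ t)).le_opNorm _).trans (by gcongr; exact hK t ⟨ht.1, ht.2.le⟩))
    1 ⟨zero_le_one, le_rfl⟩
  simpa [hγ] using this

end LinearODE

/-! ### Global existence for linear equations by Picard iteration, holomorphic in the parameter. -/

section LinearODEExistence

open MeasureTheory Metric

variable {E : Type*} [NormedAddCommGroup E] [NormedSpace ℂ E]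

/-- The integral of `B(·, ω) f(·, ω)` along the segment from `ζ₀` to `ζ`. -/
noncomputable def segmentPicard (B : ℂ → ℂ → E →L[ℂ] E) (ζ₀ : ℂ) (f : ℂ → ℂ → E) (ζ ω : ℂ) : E :=
  ∫ s in (0 : ℝ)..1, (ζ - ζ₀) • B (ζ₀ + s * (ζ - ζ₀)) ω (f (ζ₀ + s * (ζ - ζ₀)) ω)

theorem segment_mem {U : Set ℂ} (hU : Convex ℝ U) {ζ₀ ζ : ℂ} (hζ₀ : ζ₀ ∈ U) (hζ : ζ ∈ U) {s : ℝ}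
    (hs : s ∈ Set.Icc (0 : ℝ) 1) : ζ₀ + s * (ζ - ζ₀) ∈ U := by
  simpa using hU.add_smul_sub_mem hζ₀ hζ hs

variable {U Ω : Set ℂ} {B : ℂ → ℂ → E →L[ℂ] E} {ζ₀ : ℂ} {f : ℂ → ℂ → E}

theorem differentiableOn_segmentPicard (hU : Convex ℝ U) (hUo : IsOpen U) (hΩ : IsOpen Ω)
    (hB : DifferentiableOn ℂ (fun q : ℂ × ℂ => B q.1 q.2) (U ×ˢ Ω)) (hζ₀ : ζ₀ ∈ U)
    (hf : DifferentiableOn ℂ (fun q : ℂ × ℂ => f q.1 q.2) (U ×ˢ Ω)) :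
    DifferentiableOn ℂ (fun q : ℂ × ℂ => segmentPicard B ζ₀ f q.1 q.2) (U ×ˢ Ω) := by
  intro q₁ hq₁
  refine DifferentiableAt.differentiableWithinAt ?_
  obtain ⟨r, hr, hrsub⟩ := nhds_basis_closedBall.mem_iff.1 ((hUo.prod hΩ).mem_nhds hq₁)
  have hg : DifferentiableOn ℂ (fun q : ℂ × ℂ => B q.1 q.2 (f q.1 q.2)) (U ×ˢ Ω) := hB.clm_apply hf
  have hmem : ∀ s ∈ Set.Icc (0 : ℝ) 1, ∀ q ∈ closedBall q₁ r,
      ((ζ₀ + s * (q.1 - ζ₀), q.2) : ℂ × ℂ) ∈ U ×ˢ Ω := fun s hs q hq =>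
    ⟨segment_mem hU hζ₀ (hrsub hq).1 hs, (hrsub hq).2⟩
  have hcont : ContinuousOn (fun p : ℝ × (ℂ × ℂ) => (p.2.1 - ζ₀) •
      B (ζ₀ + p.1 * (p.2.1 - ζ₀)) p.2.2 (f (ζ₀ + p.1 * (p.2.1 - ζ₀)) p.2.2))
      (Set.Icc (0 : ℝ) 1 ×ˢ closedBall q₁ r) := by
    refine ContinuousOn.smul (by fun_prop) ?_
    exact hg.continuousOn.comp (f := fun p : ℝ × (ℂ × ℂ) =>
      ((ζ₀ + p.1 * (p.2.1 - ζ₀), p.2.2) : ℂ × ℂ)) (by fun_prop) fun p hp => hmem _ hp.1 _ hp.2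
  obtain ⟨C, hC⟩ := (isCompact_Icc.prod (isCompact_closedBall q₁ r)).exists_bound_of_continuousOn
    hcont
  have hball : ball q₁ r ⊆ closedBall q₁ r := ball_subset_closedBall
  have hI : ∀ᵐ s : ℝ ∂(volume.restrict (Set.Ioc (0 : ℝ) 1)), s ∈ Set.Icc (0 : ℝ) 1 := by
    filter_upwards [ae_restrict_mem measurableSet_Ioc] with s hs using Set.Ioc_subset_Icc_self hs
  simp only [segmentPicard, intervalIntegral.integral_of_le zero_le_one]
  refine differentiableAt_integral_of_dominated (bound := fun _ => C) hr ?_ (integrable_const C)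
    ?_ ?_
  · intro q hq
    refine ContinuousOn.aestronglyMeasurable (ContinuousOn.mono (s := Set.Icc (0 : ℝ) 1) ?_
      Set.Ioc_subset_Icc_self) measurableSet_Ioc
    exact hcont.comp (f := fun s : ℝ => (s, q)) (by fun_prop) fun s hs => ⟨hs, hball hq⟩
  · filter_upwards [hI] with s hs q hq using hC (s, q) ⟨hs, hball hq⟩
  · filter_upwards [hI] with s hs
    refine DifferentiableOn.smul (by fun_prop) ?_
    exact hg.comp (f := fun q : ℂ × ℂ => ((ζ₀ + s * (q.1 - ζ₀), q.2) : ℂ × ℂ)) (by fun_prop)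
      fun q hq => hmem s hs q (hball hq)

theorem DifferentiableOn.left_of_prod {F : Type*} [NormedAddCommGroup F] [NormedSpace ℂ F]
    {g : ℂ → ℂ → F} (hg : DifferentiableOn ℂ (fun q : ℂ × ℂ => g q.1 q.2) (U ×ˢ Ω)) {ω : ℂ}
    (hω : ω ∈ Ω) : DifferentiableOn ℂ (fun ζ => g ζ ω) U :=
  hg.comp (f := fun ζ : ℂ => ((ζ, ω) : ℂ × ℂ)) (by fun_prop) fun _ hζ => ⟨hζ, hω⟩

theorem DifferentiableOn.right_of_prod {F : Type*} [NormedAddCommGroup F] [NormedSpace ℂ F]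
    {g : ℂ → ℂ → F} (hg : DifferentiableOn ℂ (fun q : ℂ × ℂ => g q.1 q.2) (U ×ˢ Ω)) {ζ : ℂ}
    (hζ : ζ ∈ U) : DifferentiableOn ℂ (fun ω => g ζ ω) Ω :=
  hg.comp (f := fun ω : ℂ => ((ζ, ω) : ℂ × ℂ)) (by fun_prop) fun _ hω => ⟨hζ, hω⟩

/-- On a convex open set the holomorphic integrand has a primitive `G`, so the segment integral is
the increment of `G`. -/
theorem hasDerivAt_segmentPicard [CompleteSpace E] (hU : Convex ℝ U) (hUo : IsOpen U)
    (hB : DifferentiableOn ℂ (fun q : ℂ × ℂ => B q.1 q.2) (U ×ˢ Ω)) (hζ₀ : ζ₀ ∈ U)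
    (hf : DifferentiableOn ℂ (fun q : ℂ × ℂ => f q.1 q.2) (U ×ˢ Ω)) {ζ ω : ℂ} (hζ : ζ ∈ U)
    (hω : ω ∈ Ω) : HasDerivAt (fun ζ => segmentPicard B ζ₀ f ζ ω) (B ζ ω (f ζ ω)) ζ := by
  have hg : DifferentiableOn ℂ (fun ζ => B ζ ω (f ζ ω)) U :=
    (hB.clm_apply hf).left_of_prod (g := fun ζ ω => B ζ ω (f ζ ω)) hω
  obtain ⟨G, hG⟩ := hU.exists_forall_hasDerivWithinAt hg
  replace hG : ∀ a ∈ U, HasDerivAt G (B a ω (f a ω)) a := fun a ha =>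
    (hG a ha).hasDerivAt (hUo.mem_nhds ha)
  have heq : ∀ a ∈ U, segmentPicard B ζ₀ f a ω = G a - G ζ₀ := by
    intro a ha
    have hmem : ∀ s ∈ Set.uIcc (0 : ℝ) 1, ζ₀ + s * (a - ζ₀) ∈ U := fun s hs =>
      segment_mem hU hζ₀ ha (by rwa [Set.uIcc_of_le zero_le_one] at hs)
    have hd : ∀ s : ℝ, HasDerivAt (fun s : ℝ => ζ₀ + s * (a - ζ₀)) (a - ζ₀) s := by
      intro s
      have h1 : HasDerivAt (fun t : ℝ => (t : ℂ)) 1 s := Complex.ofRealCLM.hasDerivAt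
      simpa using (h1.mul_const (a - ζ₀)).const_add ζ₀
    have := intervalIntegral.integral_eq_sub_of_hasDerivAt
      (f := fun s : ℝ => G (ζ₀ + s * (a - ζ₀)))
      (f' := fun s : ℝ => (a - ζ₀) • B (ζ₀ + s * (a - ζ₀)) ω (f (ζ₀ + s * (a - ζ₀)) ω))
      (a := 0) (b := 1) (fun s hs => (hG _ (hmem s hs)).scomp s (hd s)) ?_
    · simpa [segmentPicard] using this
    · refine ContinuousOn.intervalIntegrable (ContinuousOn.const_smul ?_ _)
      exact hg.continuousOn.comp (f := fun s : ℝ => ζ₀ + s * (a - ζ₀)) (by fun_prop) hmem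
  refine ((hG ζ hζ).sub_const (G ζ₀)).congr_of_eventuallyEq ?_
  filter_upwards [hUo.mem_nhds hζ] with a ha using heq a ha

/-- Global solvability of a linear differential equation with holomorphic coefficients on a convex
open set, with holomorphic dependence on a parameter. -/
theorem exists_linear_ode_solution [CompleteSpace E] (hU : Convex ℝ U) (hUo : IsOpen U)
    (hΩ : IsOpen Ω) (hB : DifferentiableOn ℂ (fun q : ℂ × ℂ => B q.1 q.2) (U ×ˢ Ω)) (hζ₀ : ζ₀ ∈ U)
    {y₀ : ℂ → E} (hy₀ : DifferentiableOn ℂ y₀ Ω) :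
    ∃ y : ℂ → ℂ → E, DifferentiableOn ℂ (fun q : ℂ × ℂ => y q.1 q.2) (U ×ˢ Ω) ∧
      ∀ ω ∈ Ω, y ζ₀ ω = y₀ ω ∧ ∀ ζ ∈ U, HasDerivAt (fun ζ => y ζ ω) (B ζ ω (y ζ ω)) ζ := by
  set f : ℕ → ℂ → ℂ → E := fun m => (segmentPicard B ζ₀)^[m] (fun _ ω => y₀ ω) with hf_def
  have f_zero : f 0 = fun _ ω => y₀ ω := rfl
  have f_succ : ∀ m, f (m + 1) = segmentPicard B ζ₀ (f m) := fun m =>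
    Function.iterate_succ_apply' _ _ _
  have hfd : ∀ m, DifferentiableOn ℂ (fun q : ℂ × ℂ => f m q.1 q.2) (U ×ˢ Ω) := by
    intro m
    induction m with
    | zero =>
      exact hy₀.comp (f := fun q : ℂ × ℂ => q.2) (t := Ω) (s := U ×ˢ Ω) (by fun_prop)
        (fun q hq => hq.2)
    | succ m ih => rw [f_succ]; exact differentiableOn_segmentPicard hU hUo hΩ hB hζ₀ ih
  have hderiv : ∀ m, ∀ ω ∈ Ω, ∀ ζ ∈ U,
      HasDerivAt (fun ζ => f (m + 1) ζ ω) (B ζ ω (f m ζ ω)) ζ := by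
    intro m ω hω ζ hζ
    rw [f_succ]
    exact hasDerivAt_segmentPicard hU hUo hB hζ₀ (hfd m) hζ hω
  have hbound : ∀ q₁ ∈ U ×ˢ Ω, ∃ r > 0, ball q₁ r ⊆ U ×ˢ Ω ∧ ∃ u : ℕ → ℝ, Summable u ∧
      ∀ m, ∀ q ∈ ball q₁ r, ‖f m q.1 q.2‖ ≤ u m := by
    intro q₁ hq₁
    obtain ⟨r, hr, hrsub⟩ := nhds_basis_closedBall.mem_iff.1 ((hUo.prod hΩ).mem_nhds hq₁)
    have hcont : ContinuousOn (fun p : ℝ × (ℂ × ℂ) => (p.2.1 - ζ₀) •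
        B (ζ₀ + p.1 * (p.2.1 - ζ₀)) p.2.2) (Set.Icc (0 : ℝ) 1 ×ˢ closedBall q₁ r) := by
      have h1 : ContinuousOn (fun p : ℝ × (ℂ × ℂ) => p.2.1 - ζ₀)
          (Set.Icc (0 : ℝ) 1 ×ˢ closedBall q₁ r) := by fun_prop
      refine h1.smul ?_
      exact hB.continuousOn.comp (f := fun p : ℝ × (ℂ × ℂ) =>
        ((ζ₀ + p.1 * (p.2.1 - ζ₀), p.2.2) : ℂ × ℂ)) (by fun_prop) fun p hp =>
          ⟨segment_mem hU hζ₀ (hrsub hp.2).1 hp.1, (hrsub hp.2).2⟩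
    obtain ⟨L, hL⟩ := (isCompact_Icc.prod
      (isCompact_closedBall q₁ r)).exists_bound_of_continuousOn hcont
    obtain ⟨C, hC⟩ := (isCompact_closedBall q₁ r).exists_bound_of_continuousOn
      ((hfd 0).continuousOn.mono hrsub)
    have hL0 : 0 ≤ L := (norm_nonneg _).trans
      (hL (0, q₁) ⟨⟨le_rfl, zero_le_one⟩, mem_closedBall_self hr.le⟩)
    have hC0 : 0 ≤ C := (norm_nonneg _).trans (hC q₁ (mem_closedBall_self hr.le))
    -- The factorial gain requires the bound at every intermediate point of the segment, although
    -- only s = 1 is used afterwards. The point at parameter t on the segment ending at parameter s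
    -- has parameter st, so the induction closes.
    have key : ∀ m, ∀ q ∈ closedBall q₁ r, ∀ s ∈ Set.Icc (0 : ℝ) 1,
        ‖f m (ζ₀ + s * (q.1 - ζ₀)) q.2‖ ≤ C * ((L * s) ^ m / m.factorial) := by
      intro m q hq
      induction m with
      | zero => intro s hs; simpa [f_zero] using hC q hq
      | succ m ih =>
        intro s hs
        rw [f_succ]
        have hcalc : ∫ t in (0 : ℝ)..1, C * L ^ (m + 1) * s ^ (m + 1) / m.factorial * t ^ m =
            C * ((L * s) ^ (m + 1) / (m + 1).factorial) := by
          rw [intervalIntegral.integral_const_mul, integral_pow, Nat.factorial_succ]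
          push_cast
          field_simp
          simp
          ring
        rw [← hcalc, segmentPicard]
        refine intervalIntegral.norm_integral_le_of_norm_le zero_le_one ?_ (by
          apply Continuous.intervalIntegrable; fun_prop)
        refine Eventually.of_forall fun t ht => ?_
        have ht' : t ∈ Set.Icc (0 : ℝ) 1 := Set.Ioc_subset_Icc_self ht
        have hst : s * t ∈ Set.Icc (0 : ℝ) 1 :=
          ⟨mul_nonneg hs.1 ht'.1, mul_le_one₀ hs.2 ht'.1 ht'.2⟩
        have e1 : ζ₀ + s * (q.1 - ζ₀) - ζ₀ = s * (q.1 - ζ₀) := by ring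
        have e2 : ζ₀ + t * (s * (q.1 - ζ₀)) = ζ₀ + ((s * t : ℝ) : ℂ) * (q.1 - ζ₀) := by
          push_cast; ring
        rw [e1, e2, mul_smul, ← smul_apply, norm_smul]
        have h1 := hL (s * t, q) ⟨hst, hq⟩
        have h2 := ih (s * t) hst
        rw [Complex.norm_real, Real.norm_of_nonneg hs.1]
        calc s * ‖((q.1 - ζ₀) • B (ζ₀ + ((s * t : ℝ) : ℂ) * (q.1 - ζ₀)) q.2)
              (f m (ζ₀ + ((s * t : ℝ) : ℂ) * (q.1 - ζ₀)) q.2)‖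
            ≤ s * (L * (C * ((L * (s * t)) ^ m / m.factorial))) := by
              refine mul_le_mul_of_nonneg_left ?_ hs.1
              exact (ContinuousLinearMap.le_opNorm _ _).trans
                (mul_le_mul h1 h2 (norm_nonneg _) hL0)
          _ = C * L ^ (m + 1) * s ^ (m + 1) / m.factorial * t ^ m := by
              rw [mul_pow, mul_pow]; ring
    refine ⟨r, hr, ball_subset_closedBall.trans hrsub, fun m => C * (L ^ m / m.factorial),
      (Real.summable_pow_div_factorial L).mul_left C, fun m q hq => ?_⟩
    simpa using key m q (ball_subset_closedBall hq) 1 ⟨zero_le_one, le_rfl⟩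
  have hdiff : DifferentiableOn ℂ (fun q : ℂ × ℂ => ∑' m, f m q.1 q.2) (U ×ˢ Ω) := by
    intro q hq
    obtain ⟨r, hr, hsub, u, hu, hle⟩ := hbound q hq
    exact (differentiableAt_tsum_of_summable_norm_of_ball (f := fun m (q : ℂ × ℂ) => f m q.1 q.2)
      hr hu (fun m => (hfd m).mono hsub) hle).differentiableWithinAt
  refine ⟨fun ζ ω => ∑' m, f m ζ ω, hdiff, fun ω hω => ⟨?_, fun ζ hζ => ?_⟩⟩
  · change ∑' m, f m ζ₀ ω = y₀ ω
    refine (tsum_eq_single 0 fun m hm => ?_).trans rfl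
    obtain ⟨m, rfl⟩ := Nat.exists_eq_succ_of_ne_zero hm
    rw [Nat.succ_eq_add_one, f_succ]
    simp [segmentPicard]
  · obtain ⟨r, hr, hsub, u, hu, hle⟩ := hbound (ζ, ω) ⟨hζ, hω⟩
    have hmem : ∀ z ∈ ball ζ r, ((z, ω) : ℂ × ℂ) ∈ ball (ζ, ω) r := fun z hz => by
      rw [← ball_prod_same]; exact ⟨hz, mem_ball_self hr⟩
    have hsum : Summable fun m => f m ζ ω :=
      Summable.of_norm_bounded hu fun m => hle m (ζ, ω) (mem_ball_self hr)
    have h1 := Complex.hasSum_deriv_of_summable_norm (F := fun m z => f m z ω) hu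
      (fun m => ((hfd m).mono hsub).comp (f := fun z : ℂ => ((z, ω) : ℂ × ℂ)) (by fun_prop) hmem)
      isOpen_ball (fun m z hz => hle m (z, ω) (hmem z hz)) (mem_ball_self hr)
    have h2 : HasDerivAt (fun z => ∑' m, f m z ω) (deriv (fun z => ∑' m, f m z ω) ζ) ζ :=
      ((hdiff.left_of_prod (g := fun z ω => ∑' m, f m z ω) hω).differentiableAt
        (hUo.mem_nhds hζ)).hasDerivAt
    -- The zeroth iterate does not depend on ζ. Dropping it and shifting the index turns the series
    -- of derivatives into `B` applied to the series of iterates.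
    have h3 : deriv (fun z => ∑' m, f m z ω) ζ = B ζ ω (∑' m, f m ζ ω) := by
      refine h1.unique ?_
      rw [← hasSum_nat_add_iff' 1]
      have h4 := (B ζ ω).hasSum hsum.hasSum
      simp only [(hderiv _ ω hω ζ hζ).deriv]
      simpa [f_zero] using h4
    rwa [h3] at h2

end LinearODEExistence

/-! ### Inverting a scalar linear equation by integration from infinity along a ray. -/

section RayIntegral

open MeasureTheory Metric

theorem setIntegral_Ioi_comp_add_right {E : Type*} [NormedAddCommGroup E] [NormedSpace ℝ E]
    (f : ℝ → E) (t : ℝ) : ∫ s in Set.Ioi 0, f (s + t) = ∫ s in Set.Ioi t, f s := by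
  rw [← integral_indicator measurableSet_Ioi, ← integral_indicator measurableSet_Ioi,
    ← integral_add_right_eq_self (μ := volume) ((Set.Ioi t).indicator f) t]
  congr 1
  ext s
  simp [Set.indicator]

theorem integral_Ioi_add_rpow {x b : ℝ} (hx : 0 < x) (hb : 0 < b) :
    ∫ s in Set.Ioi (0 : ℝ), (s + x) ^ (-1 - b) = x ^ (-b) / b := by
  rw [setIntegral_Ioi_comp_add_right (fun s => s ^ (-1 - b)) x,
    integral_Ioi_rpow_of_lt (by linarith) hx, show -1 - b + 1 = -b by ring, neg_div_neg_eq]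

/-- The decaying solution operator for `F' = m' F + h`, by integration along the ray from `u` in
the direction `d`. -/
noncomputable def rayIntegral (m h : ℂ → ℂ → ℂ) (d u ω : ℂ) : ℂ :=
  -∫ s in Set.Ioi (0 : ℝ), Complex.exp (m u ω - m (u + s * d) ω) * h (u + s * d) ω * d

variable {D Ω : Set ℂ} {m h : ℂ → ℂ → ℂ} {d : ℂ} {c N A b : ℝ}

/-- The real part of `m` on the ray is never below its initial value, so the exponential has modulus
at most 1. Integrability comes only from the decay of `h` and the linear growth of the distance to
the origin. -/
theorem norm_rayIntegrand_le (hd : ‖d‖ ≤ 2) (hc : 0 < c) (hb : 0 < b) (hA : 0 ≤ A)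
    (hray : ∀ u ∈ D, ∀ s : ℝ, 0 ≤ s → u + s * d ∈ D)
    (hlow : ∀ u ∈ D, ∀ s : ℝ, 0 ≤ s → c * (‖u‖ + s) ≤ ‖u + s * d‖)
    (hpos : ∀ u ∈ D, 0 < ‖u‖)
    (hle : ∀ u ∈ D, ∀ ω ∈ Ω, ‖h u ω‖ ≤ A * ‖u‖ ^ (-1 - b))
    (hre : ∀ u ∈ D, ∀ ω ∈ Ω, ∀ s : ℝ, 0 ≤ s → 0 ≤ (m (u + s * d) ω - m u ω).re)
    {u ω : ℂ} (hu : u ∈ D) (hω : ω ∈ Ω) {s : ℝ} (hs : 0 ≤ s) :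
    ‖Complex.exp (m u ω - m (u + s * d) ω) * h (u + s * d) ω * d‖ ≤
      2 * A * c ^ (-1 - b) * (s + ‖u‖) ^ (-1 - b) := by
  have h1 : ‖Complex.exp (m u ω - m (u + s * d) ω)‖ ≤ 1 := by
    rw [Complex.norm_exp, Real.exp_le_one_iff]
    have := hre u hu ω hω s hs
    simp only [Complex.sub_re] at this ⊢
    linarith
  have hpu := hpos u hu
  have h2 : ‖h (u + s * d) ω‖ ≤ A * (c * (‖u‖ + s)) ^ (-1 - b) := by
    refine (hle _ (hray u hu s hs) ω hω).trans (mul_le_mul_of_nonneg_left ?_ hA)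
    exact Real.rpow_le_rpow_of_nonpos (by positivity) (hlow u hu s hs) (by linarith)
  rw [norm_mul, norm_mul]
  calc _ ≤ 1 * (A * (c * (‖u‖ + s)) ^ (-1 - b)) * 2 := by gcongr
    _ = _ := by rw [Real.mul_rpow hc.le (by positivity), add_comm s]; ring

theorem norm_rayIntegral_le (hd : ‖d‖ ≤ 2) (hc : 0 < c) (hb : 0 < b) (hA : 0 ≤ A)
    (hray : ∀ u ∈ D, ∀ s : ℝ, 0 ≤ s → u + s * d ∈ D)
    (hlow : ∀ u ∈ D, ∀ s : ℝ, 0 ≤ s → c * (‖u‖ + s) ≤ ‖u + s * d‖)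
    (hpos : ∀ u ∈ D, 0 < ‖u‖)
    (hle : ∀ u ∈ D, ∀ ω ∈ Ω, ‖h u ω‖ ≤ A * ‖u‖ ^ (-1 - b))
    (hre : ∀ u ∈ D, ∀ ω ∈ Ω, ∀ s : ℝ, 0 ≤ s → 0 ≤ (m (u + s * d) ω - m u ω).re)
    {u ω : ℂ} (hu : u ∈ D) (hω : ω ∈ Ω) :
    ‖rayIntegral m h d u ω‖ ≤ 2 * c ^ (-1 - b) / b * A * ‖u‖ ^ (-b) := by
  have hpu := hpos u hu
  have hint : IntegrableOn (fun s : ℝ => 2 * A * c ^ (-1 - b) * (s + ‖u‖) ^ (-1 - b))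
      (Set.Ioi 0) :=
    (integrableOn_add_rpow_Ioi_of_lt (by linarith) (by linarith)).const_mul _
  rw [rayIntegral, norm_neg]
  refine (norm_integral_le_of_norm_le hint ?_).trans_eq ?_
  · filter_upwards [ae_restrict_mem measurableSet_Ioi] with s hs
    exact norm_rayIntegrand_le hd hc hb hA hray hlow hpos hle hre hu hω (le_of_lt hs)
  · rw [integral_const_mul, integral_Ioi_add_rpow hpu hb]
    ring

theorem differentiableOn_rayIntegral (hD : IsOpen D) (hΩ : IsOpen Ω) (hd : ‖d‖ ≤ 2) (hc : 0 < c)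
    (hb : 0 < b) (hA : 0 ≤ A) (hN : 0 < N)
    (hray : ∀ u ∈ D, ∀ s : ℝ, 0 ≤ s → u + s * d ∈ D)
    (hlow : ∀ u ∈ D, ∀ s : ℝ, 0 ≤ s → c * (‖u‖ + s) ≤ ‖u + s * d‖)
    (hDN : ∀ u ∈ D, N ≤ ‖u‖)
    (hm : DifferentiableOn ℂ (fun q : ℂ × ℂ => m q.1 q.2) (D ×ˢ Ω))
    (hh : DifferentiableOn ℂ (fun q : ℂ × ℂ => h q.1 q.2) (D ×ˢ Ω))
    (hle : ∀ u ∈ D, ∀ ω ∈ Ω, ‖h u ω‖ ≤ A * ‖u‖ ^ (-1 - b))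
    (hre : ∀ u ∈ D, ∀ ω ∈ Ω, ∀ s : ℝ, 0 ≤ s → 0 ≤ (m (u + s * d) ω - m u ω).re) :
    DifferentiableOn ℂ (fun q : ℂ × ℂ => rayIntegral m h d q.1 q.2) (D ×ˢ Ω) := by
  intro q₁ hq₁
  refine DifferentiableAt.differentiableWithinAt ?_
  obtain ⟨r, hr, hsub⟩ := Metric.mem_nhds_iff.1 ((hD.prod hΩ).mem_nhds hq₁)
  unfold rayIntegral
  refine DifferentiableAt.neg ?_
  refine differentiableAt_integral_of_dominated
    (bound := fun s => 2 * A * c ^ (-1 - b) * (s + N) ^ (-1 - b)) hr ?_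
    ((integrableOn_add_rpow_Ioi_of_lt (by linarith) (by linarith)).const_mul _) ?_ ?_
  · intro q hq
    refine ContinuousOn.aestronglyMeasurable ?_ measurableSet_Ioi
    have hmem : ∀ s ∈ Set.Ioi (0 : ℝ), ((q.1 + s * d, q.2) : ℂ × ℂ) ∈ D ×ˢ Ω := fun s hs =>
      ⟨hray _ (hsub hq).1 s (le_of_lt hs), (hsub hq).2⟩
    have h1 : ContinuousOn (fun s : ℝ => m (q.1 + s * d) q.2) (Set.Ioi 0) :=
      hm.continuousOn.comp (f := fun s : ℝ => ((q.1 + s * d, q.2) : ℂ × ℂ)) (by fun_prop) hmem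
    have h2 : ContinuousOn (fun s : ℝ => h (q.1 + s * d) q.2) (Set.Ioi 0) :=
      hh.continuousOn.comp (f := fun s : ℝ => ((q.1 + s * d, q.2) : ℂ × ℂ)) (by fun_prop) hmem
    exact ((continuousOn_const.sub h1).cexp.mul h2).mul continuousOn_const
  · filter_upwards [ae_restrict_mem measurableSet_Ioi] with s hs q hq
    have hs' : (0 : ℝ) < s := hs
    refine (norm_rayIntegrand_le hd hc hb hA hray hlow (fun u hu => hN.trans_le (hDN u hu)) hle
      hre (hsub hq).1 (hsub hq).2 hs'.le).trans ?_
    refine mul_le_mul_of_nonneg_left ?_ (by positivity)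
    refine Real.rpow_le_rpow_of_nonpos (by positivity) ?_ (by linarith)
    linarith [hDN _ (hsub hq).1]
  · filter_upwards [ae_restrict_mem measurableSet_Ioi] with s hs
    have hmem : ∀ q ∈ ball q₁ r, ((q.1 + s * d, q.2) : ℂ × ℂ) ∈ D ×ˢ Ω := fun q hq =>
      ⟨hray _ (hsub hq).1 s (le_of_lt hs), (hsub hq).2⟩
    have h0 : DifferentiableOn ℂ (fun q : ℂ × ℂ => m q.1 q.2) (ball q₁ r) := hm.mono hsub
    have h1 : DifferentiableOn ℂ (fun q : ℂ × ℂ => m (q.1 + s * d) q.2) (ball q₁ r) :=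
      hm.comp (f := fun q : ℂ × ℂ => ((q.1 + s * d, q.2) : ℂ × ℂ)) (by fun_prop) hmem
    have h2 : DifferentiableOn ℂ (fun q : ℂ × ℂ => h (q.1 + s * d) q.2) (ball q₁ r) :=
      hh.comp (f := fun q : ℂ × ℂ => ((q.1 + s * d, q.2) : ℂ × ℂ)) (by fun_prop) hmem
    exact ((h0.sub h1).cexp.mul h2).mul_const d

/-- Holomorphy is already known, so the complex derivative can be read off along the ray itself.
There exp(-m) times the integral is minus the tail of a fixed function `g`, and the fundamental
theorem of calculus applies. -/
theorem hasDerivAt_rayIntegral (hD : IsOpen D) (hΩ : IsOpen Ω) (hd : ‖d‖ ≤ 2) (hd0 : d ≠ 0)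
    (hc : 0 < c) (hb : 0 < b) (hA : 0 ≤ A) (hN : 0 < N)
    (hray : ∀ u ∈ D, ∀ s : ℝ, 0 ≤ s → u + s * d ∈ D)
    (hlow : ∀ u ∈ D, ∀ s : ℝ, 0 ≤ s → c * (‖u‖ + s) ≤ ‖u + s * d‖)
    (hDN : ∀ u ∈ D, N ≤ ‖u‖)
    (hm : DifferentiableOn ℂ (fun q : ℂ × ℂ => m q.1 q.2) (D ×ˢ Ω))
    (hh : DifferentiableOn ℂ (fun q : ℂ × ℂ => h q.1 q.2) (D ×ˢ Ω))
    (hle : ∀ u ∈ D, ∀ ω ∈ Ω, ‖h u ω‖ ≤ A * ‖u‖ ^ (-1 - b))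
    (hre : ∀ u ∈ D, ∀ ω ∈ Ω, ∀ s : ℝ, 0 ≤ s → 0 ≤ (m (u + s * d) ω - m u ω).re)
    {u ω : ℂ} (hu : u ∈ D) (hω : ω ∈ Ω) :
    HasDerivAt (fun u => rayIntegral m h d u ω)
      (deriv (fun u => m u ω) u * rayIntegral m h d u ω + h u ω) u := by
  have hFd := differentiableOn_rayIntegral hD hΩ hd hc hb hA hN hray hlow hDN hm hh hle hre
  have hF : HasDerivAt (fun u => rayIntegral m h d u ω)
      (deriv (fun u => rayIntegral m h d u ω) u) u :=
    ((hFd.left_of_prod (g := rayIntegral m h d) hω).differentiableAt (hD.mem_nhds hu)).hasDerivAt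
  have hmd := hm.left_of_prod (g := m) hω
  have hhd := hh.left_of_prod (g := h) hω
  have hm' : HasDerivAt (fun u => m u ω) (deriv (fun u => m u ω) u) u :=
    (hmd.differentiableAt (hD.mem_nhds hu)).hasDerivAt
  set F' := deriv (fun u => rayIntegral m h d u ω) u
  set m' := deriv (fun u => m u ω) u
  -- the function integrated along the ray, and the integral without its exponential factor
  set g : ℝ → ℂ := fun s => Complex.exp (-m (u + s * d) ω) * h (u + s * d) ω * d with hg
  have hmem : ∀ s ∈ Set.Ici (0 : ℝ), u + s * d ∈ D := fun s hs => hray u hu s hs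
  have hgc : ContinuousOn g (Set.Ici 0) := by
    have h1 : ContinuousOn (fun s : ℝ => m (u + s * d) ω) (Set.Ici 0) :=
      hmd.continuousOn.comp (f := fun s : ℝ => u + s * d) (by fun_prop) hmem
    have h2 : ContinuousOn (fun s : ℝ => h (u + s * d) ω) (Set.Ici 0) :=
      hhd.continuousOn.comp (f := fun s : ℝ => u + s * d) (by fun_prop) hmem
    exact (h1.neg.cexp.mul h2).mul continuousOn_const
  have hgint : IntegrableOn g (Set.Ioi 0) := by
    have hpu : 0 < ‖u‖ := hN.trans_le (hDN u hu)
    have hint : IntegrableOn (fun s : ℝ => ‖Complex.exp (-m u ω)‖ *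
        (2 * A * c ^ (-1 - b) * (s + ‖u‖) ^ (-1 - b))) (Set.Ioi 0) :=
      ((integrableOn_add_rpow_Ioi_of_lt (by linarith) (by linarith)).const_mul _).const_mul _
    refine hint.mono' ((hgc.mono Set.Ioi_subset_Ici_self).aestronglyMeasurable
      measurableSet_Ioi) ?_
    filter_upwards [ae_restrict_mem measurableSet_Ioi] with s hs
    have h1 := norm_rayIntegrand_le hd hc hb hA hray hlow
      (fun u hu => hN.trans_le (hDN u hu)) hle hre hu hω (le_of_lt hs)
    have h2 : g s = Complex.exp (-m u ω) *
        (Complex.exp (m u ω - m (u + s * d) ω) * h (u + s * d) ω * d) := by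
      rw [← mul_assoc, ← mul_assoc, ← Complex.exp_add, neg_add_eq_sub, sub_sub_cancel_left]
    rw [h2, norm_mul]
    gcongr
  have hG : ∀ t : ℝ, 0 ≤ t → Complex.exp (-m (u + t * d) ω) * rayIntegral m h d (u + t * d) ω =
      (∫ s in (0 : ℝ)..t, g s) - ∫ s in Set.Ioi 0, g s := by
    intro t ht
    have h1 := setIntegral_Ioi_comp_add_right g t
    have h2 := intervalIntegral.integral_Ioi_sub_Ioi hgint ht
    rw [← h2, rayIntegral, mul_neg, ← integral_const_mul, sub_sub_cancel_left, ← h1]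
    congr 1
    refine integral_congr_ae (Eventually.of_forall fun s => ?_)
    have e1 : u + t * d + s * d = u + ((s + t : ℝ) : ℂ) * d := by push_cast; ring
    simp only [hg]
    rw [e1, ← mul_assoc, ← mul_assoc, ← Complex.exp_add, neg_add_eq_sub, sub_sub_cancel_left]
  have hline : HasDerivAt (fun t : ℝ => u + t * d) d 0 := by
    have h1 : HasDerivAt (fun t : ℝ => (t : ℂ)) 1 0 := Complex.ofRealCLM.hasDerivAt
    simpa using (h1.mul_const d).const_add u
  have hL : HasDerivAt (fun t : ℝ => Complex.exp (-m (u + t * d) ω) *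
      rayIntegral m h d (u + t * d) ω)
      ((Complex.exp (-m u ω) * (-m') * rayIntegral m h d u ω + Complex.exp (-m u ω) * F') * d)
      0 := by
    have h1 : HasDerivAt (fun v => Complex.exp (-m v ω) * rayIntegral m h d v ω)
      (Complex.exp (-m u ω) * (-m') * rayIntegral m h d u ω + Complex.exp (-m u ω) * F')
      (u + (0 : ℝ) * d) := by
      simpa using hm'.fun_neg.cexp.fun_mul hF
    exact h1.comp 0 hline
  have hR : HasDerivWithinAt (fun t : ℝ => (∫ s in (0 : ℝ)..t, g s) - ∫ s in Set.Ioi 0, g s)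
      (g 0) (Set.Ici 0) 0 := by
    refine HasDerivWithinAt.sub_const _ ?_
    refine intervalIntegral.integral_hasDerivWithinAt_right (t := Set.Ioi 0)
      IntervalIntegrable.refl ?_ ((hgc 0 Set.self_mem_Ici).mono Set.Ioi_subset_Ici_self)
    exact ⟨Set.Ioi 0, self_mem_nhdsWithin,
      (hgc.mono Set.Ioi_subset_Ici_self).aestronglyMeasurable measurableSet_Ioi⟩
  -- The ray exists only for t ≥ 0, so two one-sided derivatives are compared at 0. Both carry the
  -- factor `d`, which is cancelled below.
  have heq := (uniqueDiffWithinAt_Ici (0 : ℝ)).eq_deriv _ (hL.hasDerivWithinAt (s := Set.Ici 0))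
    (hR.congr (fun t ht => hG t ht) (hG 0 le_rfl))
  have hfin : F' = m' * rayIntegral m h d u ω + h u ω := by
    have hE := Complex.exp_ne_zero (-m u ω)
    simp only [hg, Complex.ofReal_zero, zero_mul, add_zero] at heq
    have h3 := mul_right_cancel₀ hd0 heq
    have h4 : Complex.exp (-m u ω) * (F' - m' * rayIntegral m h d u ω) =
        Complex.exp (-m u ω) * h u ω := by rw [← h3]; ring
    have h5 := mul_left_cancel₀ hE h4
    rw [← h5]; ring
  rwa [hfin] at hF

end RayIntegral

/-! ### The Volterra system with a separate ray direction for each component. -/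

section RaySolution

open MeasureTheory Metric

/-- Solution of the Volterra system `φₖ' = mₖ' (φₖ - eₖ) + (S φ)ₖ` which tends to the constant
vector `e` at infinity, where the `k`-th component is integrated along rays in the
direction `d k`. -/
theorem exists_ray_solution {n : ℕ} {D Ω : Set ℂ} {d : Fin n → ℂ} {c N C b : ℝ}
    (hD : IsOpen D) (hΩ : IsOpen Ω) (hd : ∀ k, ‖d k‖ ≤ 2) (hd0 : ∀ k, d k ≠ 0)
    (hc : 0 < c) (hb : 0 < b) (hC : 0 ≤ C) (hN : 0 < N)
    (hray : ∀ k, ∀ u ∈ D, ∀ s : ℝ, 0 ≤ s → u + s * d k ∈ D)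
    (hlow : ∀ k, ∀ u ∈ D, ∀ s : ℝ, 0 ≤ s → c * (‖u‖ + s) ≤ ‖u + s * d k‖)
    (hDN : ∀ u ∈ D, N ≤ ‖u‖)
    {m : Fin n → ℂ → ℂ → ℂ} (hm : ∀ k, DifferentiableOn ℂ (fun q : ℂ × ℂ => m k q.1 q.2) (D ×ˢ Ω))
    (hre : ∀ k, ∀ u ∈ D, ∀ ω ∈ Ω, ∀ s : ℝ, 0 ≤ s → 0 ≤ (m k (u + s * d k) ω - m k u ω).re)
    {S : ℂ → ℂ → (Fin n → ℂ) →L[ℂ] (Fin n → ℂ)}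
    (hS : DifferentiableOn ℂ (fun q : ℂ × ℂ => S q.1 q.2) (D ×ˢ Ω))
    (hSle : ∀ u ∈ D, ∀ ω ∈ Ω, ‖S u ω‖ ≤ C * ‖u‖ ^ (-1 - b))
    (hsmall : 2 * c ^ (-1 - b) / b * C * N ^ (-b) ≤ 1 / 2) (e : Fin n → ℂ) :
    ∃ φ : ℂ → ℂ → Fin n → ℂ, DifferentiableOn ℂ (fun q : ℂ × ℂ => φ q.1 q.2) (D ×ˢ Ω) ∧
      (∃ C' : ℝ, ∀ u ∈ D, ∀ ω ∈ Ω, ‖φ u ω - e‖ ≤ C' * ‖u‖ ^ (-b)) ∧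
      ∀ u ∈ D, ∀ ω ∈ Ω, ∀ k, HasDerivAt (fun u => φ u ω k)
        (deriv (fun u => m k u ω) u * (φ u ω k - e k) + S u ω (φ u ω) k) u := by
  set K := 2 * c ^ (-1 - b) / b with hK
  have hK0 : 0 ≤ K := by positivity
  -- The solution is the Neumann series of φ = e + T φ, whose terms are the iterates of `T` on the
  -- constant `e`. By `hsmall`, `T` halves uniform bounds.
  set T : (ℂ → ℂ → Fin n → ℂ) → ℂ → ℂ → Fin n → ℂ := fun f u ω k =>
    rayIntegral (m k) (fun u ω => S u ω (f u ω) k) (d k) u ω with hT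
  set f : ℕ → ℂ → ℂ → Fin n → ℂ := fun i => T^[i] (fun _ _ => e) with hf
  have f_zero : f 0 = fun _ _ => e := rfl
  have f_succ : ∀ i, f (i + 1) = T (f i) := fun i => Function.iterate_succ_apply' _ _ _
  have hpos : ∀ u ∈ D, 0 < ‖u‖ := fun u hu => hN.trans_le (hDN u hu)
  have hcomp : ∀ (i : ℕ) (a : ℝ), (∀ u ∈ D, ∀ ω ∈ Ω, ‖f i u ω‖ ≤ a) →
      ∀ k, ∀ u ∈ D, ∀ ω ∈ Ω, ‖S u ω (f i u ω) k‖ ≤ (C * a) * ‖u‖ ^ (-1 - b) := by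
    intro i a ha k u hu ω hω
    refine (norm_le_pi_norm _ k).trans (((S u ω).le_opNorm _).trans ?_)
    calc ‖S u ω‖ * ‖f i u ω‖ ≤ (C * ‖u‖ ^ (-1 - b)) * a := by
          have := hSle u hu ω hω
          have := ha u hu ω hω
          gcongr
      _ = _ := by ring
  have main : ∀ i, DifferentiableOn ℂ (fun q : ℂ × ℂ => f i q.1 q.2) (D ×ˢ Ω) ∧
      ∀ u ∈ D, ∀ ω ∈ Ω, ‖f i u ω‖ ≤ ‖e‖ * (1 / 2) ^ i := by
    intro i
    induction i with
    | zero => exact ⟨by rw [f_zero]; exact differentiableOn_const _, by simp [f_zero]⟩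
    | succ i ih =>
      have hh : ∀ k, DifferentiableOn ℂ (fun q : ℂ × ℂ => S q.1 q.2 (f i q.1 q.2) k) (D ×ˢ Ω) :=
        fun k => differentiableOn_pi.1 (hS.clm_apply ih.1) k
      have hA : 0 ≤ C * (‖e‖ * (1 / 2) ^ i) := by positivity
      rw [f_succ]
      refine ⟨differentiableOn_pi.2 fun k => ?_, fun u hu ω hω => ?_⟩
      · exact differentiableOn_rayIntegral hD hΩ (hd k) hc hb hA hN (hray k) (hlow k) hDN (hm k)
          (hh k) (hcomp i _ ih.2 k) (hre k)
      · refine (pi_norm_le_iff_of_nonneg (by positivity)).2 fun k => ?_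
        refine (norm_rayIntegral_le (hd k) hc hb hA (hray k) (hlow k) hpos (hcomp i _ ih.2 k)
          (hre k) hu hω).trans ?_
        have h1 : ‖u‖ ^ (-b) ≤ N ^ (-b) :=
          Real.rpow_le_rpow_of_nonpos hN (hDN u hu) (by linarith)
        calc K * (C * (‖e‖ * (1 / 2) ^ i)) * ‖u‖ ^ (-b)
            ≤ K * (C * (‖e‖ * (1 / 2) ^ i)) * N ^ (-b) := by gcongr
          _ = (K * C * N ^ (-b)) * (‖e‖ * (1 / 2) ^ i) := by ring
          _ ≤ (1 / 2) * (‖e‖ * (1 / 2) ^ i) := by gcongr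
          _ = _ := by ring
  -- The decay produced by the last integration is kept here rather than bounded by its value at
  -- `N`. Summing these estimates gives the rate of φ - e.
  have hsucc : ∀ i, ∀ u ∈ D, ∀ ω ∈ Ω,
      ‖f (i + 1) u ω‖ ≤ K * C * ‖e‖ * ‖u‖ ^ (-b) * (1 / 2) ^ i := by
    intro i u hu ω hω
    have hA : 0 ≤ C * (‖e‖ * (1 / 2) ^ i) := by positivity
    rw [f_succ]
    refine (pi_norm_le_iff_of_nonneg (by positivity)).2 fun k => ?_
    refine (norm_rayIntegral_le (hd k) hc hb hA (hray k) (hlow k) hpos (hcomp i _ (main i).2 k)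
      (hre k) hu hω).trans_eq (by ring)
  have hgeo : Summable fun i : ℕ => ‖e‖ * (1 / 2 : ℝ) ^ i := summable_geometric_two.mul_left _
  have hsum : ∀ u ∈ D, ∀ ω ∈ Ω, Summable fun i => f i u ω := fun u hu ω hω =>
    Summable.of_norm_bounded hgeo fun i => (main i).2 u hu ω hω
  have hdiff : DifferentiableOn ℂ (fun q : ℂ × ℂ => ∑' i, f i q.1 q.2) (D ×ˢ Ω) := by
    intro q hq
    obtain ⟨r, hr, hsub⟩ := Metric.mem_nhds_iff.1 ((hD.prod hΩ).mem_nhds hq)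
    exact (differentiableAt_tsum_of_summable_norm_of_ball (f := fun i (q : ℂ × ℂ) => f i q.1 q.2)
      hr hgeo (fun i => (main i).1.mono hsub)
      fun i q hq => (main i).2 _ (hsub hq).1 _ (hsub hq).2).differentiableWithinAt
  refine ⟨fun u ω => ∑' i, f i u ω, hdiff, ⟨K * C * ‖e‖ * 2, fun u hu ω hω => ?_⟩,
    fun u hu ω hω k => ?_⟩
  · change ‖∑' i, f i u ω - e‖ ≤ _
    rw [(hsum u hu ω hω).tsum_eq_zero_add, f_zero, add_sub_cancel_left]
    refine (tsum_of_norm_bounded (summable_geometric_two.mul_left _).hasSum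
      fun i => hsucc i u hu ω hω).trans_eq ?_
    rw [tsum_mul_left, tsum_geometric_two]
    ring
  · have hfi : ∀ i, DifferentiableOn ℂ (fun u => f i u ω) D := fun i =>
      (main i).1.left_of_prod (g := f i) hω
    have h1 := Complex.hasSum_deriv_of_summable_norm (F := fun i z => f i z ω k) hgeo
      (fun i => differentiableOn_pi.1 (hfi i) k) hD
      (fun i z hz => (norm_le_pi_norm _ k).trans ((main i).2 z hz ω hω)) hu
    have happ : ∀ z ∈ D, (∑' i, f i z ω) k = ∑' i, f i z ω k := fun z hz =>
      tsum_apply (hsum z hz ω hω)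
    have hds : HasDerivAt (fun z => (∑' i, f i z ω) k)
        (deriv (fun z => (∑' i, f i z ω) k) u) u :=
      ((differentiableOn_pi.1 (hdiff.left_of_prod (g := fun z ω => ∑' i, f i z ω) hω)
        k).differentiableAt (hD.mem_nhds hu)).hasDerivAt
    have hdeq : deriv (fun z => (∑' i, f i z ω) k) u = deriv (fun z => ∑' i, f i z ω k) u :=
      Filter.EventuallyEq.deriv_eq (by filter_upwards [hD.mem_nhds hu] with z hz using happ z hz)
    have hfd : ∀ i, deriv (fun z => f (i + 1) z ω k) u =
        deriv (fun u => m k u ω) u * f (i + 1) u ω k + S u ω (f i u ω) k := by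
      intro i
      have hA : 0 ≤ C * (‖e‖ * (1 / 2) ^ i) := by positivity
      rw [f_succ]
      exact (hasDerivAt_rayIntegral hD hΩ (hd k) (hd0 k) hc hb hA hN (hray k) (hlow k) hDN (hm k)
        (differentiableOn_pi.1 (hS.clm_apply (main i).1) k)
        (hcomp i _ (main i).2 k) (hre k) hu hω).deriv
    have h3 : deriv (fun z => (∑' i, f i z ω) k) u =
        deriv (fun u => m k u ω) u * ((∑' i, f i u ω) k - e k) + S u ω (∑' i, f i u ω) k := by
      rw [hdeq]
      refine h1.unique ?_
      have hs := hsum u hu ω hω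
      have hk : HasSum (fun i => f i u ω k) ((∑' i, f i u ω) k) := Pi.hasSum.1 hs.hasSum k
      -- The sum without its zeroth term is φ - e. This is why the diagonal part acts on φ - e in
      -- the resulting equation.
      have hk1 : HasSum (fun i => f (i + 1) u ω k) ((∑' i, f i u ω) k - e k) := by
        have := (hasSum_nat_add_iff' 1).2 hk
        simpa [f_zero] using this
      have hSk : HasSum (fun i => S u ω (f i u ω) k) (S u ω (∑' i, f i u ω) k) :=
        Pi.hasSum.1 ((S u ω).hasSum hs.hasSum) k
      rw [← hasSum_nat_add_iff' 1]
      simpa [f_zero, hfd] using (hk1.mul_left (deriv (fun u => m k u ω) u)).add hSk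
    rwa [h3] at hds

end RaySolution

/-! ### Domains stable under nearly vertical rays. -/

section RayGeometry

/-- The exterior of a blunt wedge around the negative real axis. -/
def wedgeExterior (ε N : ℝ) : Set ℂ := {u | N < u.re + ε / 2 * |u.im|}

theorem isOpen_wedgeExterior (ε N : ℝ) : IsOpen (wedgeExterior ε N) :=
  isOpen_lt continuous_const (by fun_prop)

variable {ε N : ℝ} {u d : ℂ} {s : ℝ}

theorem wedgeExterior_subset_slitPlane (hN : 0 < N) : wedgeExterior ε N ⊆ Complex.slitPlane := by
  intro u hu
  rw [Complex.mem_slitPlane_iff]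
  by_contra! h
  have hu' : N < u.re + ε / 2 * |u.im| := hu
  rw [h.2] at hu'
  simp at hu'
  linarith [h.1]

theorem half_le_norm_of_mem_wedgeExterior (hε1 : ε ≤ 1) (hu : u ∈ wedgeExterior ε N) :
    N / 2 ≤ ‖u‖ := by
  have hu' : N < u.re + ε / 2 * |u.im| := hu
  have h1 := (le_abs_self _).trans (Complex.abs_re_le_norm u)
  have h2 := Complex.abs_im_le_norm u
  have h3 : ε / 2 * |u.im| ≤ 1 / 2 * ‖u‖ := by gcongr
  linarith [norm_nonneg u]

/-- The real part grows at rate ε and |Im u| falls at most at rate 1. With weight ε/2 on |Im u|, the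
defining quantity still gains at least ε/2 per unit of s. -/
theorem wedgeExterior_ray (hε : 0 < ε) (hd : d = ε + Complex.I ∨ d = ε - Complex.I)
    (hu : u ∈ wedgeExterior ε N) (hs : 0 ≤ s) : u + s * d ∈ wedgeExterior ε N := by
  have hu' : N < u.re + ε / 2 * |u.im| := hu
  have hre : (u + s * d).re = u.re + s * ε := by rcases hd with rfl | rfl <;> simp
  have him : |u.im| - s ≤ |(u + s * d).im| := by
    have : |(u + s * d).im - u.im| = s := by
      rcases hd with rfl | rfl <;> simp [abs_of_nonneg hs]
    have h2 := abs_sub_abs_le_abs_sub u.im (u + s * d).im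
    rw [abs_sub_comm, this] at h2
    linarith
  change N < (u + s * d).re + ε / 2 * |(u + s * d).im|
  rw [hre]
  nlinarith [mul_nonneg hs hε.le]

/-- The weight 3ε/4 on |Im u| lies strictly between ε/2 and ε. Being below ε, it leaves a gain of
ε/4 in s along the ray; being above the ε/2 of the domain, it makes the initial value control ‖u‖.
-/
theorem norm_add_ray_ge (hε : 0 < ε) (hε1 : ε ≤ 1) (hN : 0 < N)
    (hd : d = ε + Complex.I ∨ d = ε - Complex.I)
    (hu : u ∈ wedgeExterior ε N) (hs : 0 ≤ s) : ε / 16 * (‖u‖ + s) ≤ ‖u + s * d‖ := by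
  have hu' : N < u.re + ε / 2 * |u.im| := hu
  have hnorm := Complex.norm_le_abs_re_add_abs_im u
  have hre : (u + s * d).re = u.re + s * ε := by rcases hd with rfl | rfl <;> simp
  have him : (u + s * d).im = u.im + s ∨ (u + s * d).im = u.im - s := by
    rcases hd with rfl | rfl
    · left; simp
    · right; simp [sub_eq_add_neg]
  have hre_le := (le_abs_self _).trans (Complex.abs_re_le_norm (u + s * d))
  have him_le := Complex.abs_im_le_norm (u + s * d)
  rw [hre] at hre_le
  have h1 : 3 / 4 * ε * |(u + s * d).im| ≤ 3 / 4 * ‖u + s * d‖ := by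
    have : ε * |(u + s * d).im| ≤ 1 * ‖u + s * d‖ := by gcongr
    linarith
  have h2 : |u.im| - s ≤ |(u + s * d).im| := by
    rcases him with h | h <;> rw [h]
    · have := abs_sub_abs_le_abs_sub u.im (-s)
      rw [abs_neg, abs_of_nonneg hs, sub_neg_eq_add] at this
      exact this
    · have := abs_sub_abs_le_abs_sub u.im s
      rwa [abs_of_nonneg hs] at this
  have h3 : u.re + 3 / 4 * ε * |u.im| + s * ε / 4 ≤ 7 / 4 * ‖u + s * d‖ := by nlinarith
  have h4 : ε / 4 * (|u.re| + |u.im|) / 2 ≤ u.re + 3 / 4 * ε * |u.im| := by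
    rcases abs_cases u.re with ⟨h, _⟩ | ⟨h, _⟩ <;> rw [h] <;>
      nlinarith [abs_nonneg u.im, mul_nonneg hε.le (abs_nonneg u.im)]
  nlinarith [mul_nonneg hε.le (norm_nonneg u)]

/-- Directions of growth of `exp (l k * u)`, all close to the imaginary axis. -/
theorem exists_ray_directions {n : ℕ} (l : Fin n → ℂ) (hl : ∀ k, l k = 0 ∨ (l k).im ≠ 0) :
    ∃ ε : ℝ, 0 < ε ∧ ε ≤ 1 ∧ ∃ d : Fin n → ℂ, ∀ k,
      (d k = ε + Complex.I ∨ d k = ε - Complex.I) ∧ (l k = 0 ∨ 0 < (l k * d k).re) := by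
  -- Since Re(l (ε ± i)) = ε Re l ∓ Im l, a suitable sign makes the last term |Im l|, which
  -- dominates for small ε. A single ε for all components lets all rays live in one domain.
  have h1 : ∀ k, ∀ᶠ ε : ℝ in 𝓝[>] 0, l k = 0 ∨ ε * |(l k).re| < |(l k).im| := by
    intro k
    rcases hl k with h | h
    · exact Eventually.of_forall fun _ => Or.inl h
    · have : Tendsto (fun ε : ℝ => ε * |(l k).re|) (𝓝[>] 0) (𝓝 (0 * |(l k).re|)) :=
        (tendsto_id.mono_left nhdsWithin_le_nhds).mul_const _
      rw [zero_mul] at this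
      exact (this.eventually_lt_const (abs_pos.2 h)).mono fun _ => Or.inr
  have h2 : ∀ᶠ ε : ℝ in 𝓝[>] 0, ε ∈ Set.Ioc (0 : ℝ) 1 := Ioc_mem_nhdsGT one_pos
  obtain ⟨ε, hε, hε1⟩ := ((eventually_all.2 h1).and h2).exists
  refine ⟨ε, hε1.1, hε1.2, fun k => if (l k).im < 0 then ε + Complex.I else ε - Complex.I,
    fun k => ⟨by dsimp only; split_ifs <;> simp, ?_⟩⟩
  refine (hε k).imp id fun h => ?_
  have h3 : -(ε * |(l k).re|) ≤ ε * (l k).re := by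
    have := neg_abs_le (l k).re
    nlinarith [hε1.1]
  dsimp only
  split_ifs with h0
  · rw [abs_of_neg h0] at h
    simp
    linarith
  · rw [abs_of_nonneg (not_lt.1 h0)] at h
    simp
    linarith

end RayGeometry

/-! ### The system in the variable ζ = ln z, and the change of variable to u = z^κ e^{-iθ}. -/

section ReducedSystem

open PuncturedCover

/-- `P` is a holomorphic phase with derivative `q` asymptotic to `exp (κ ζ)`, uniformly in the
parameter. -/
structure IsPhase (κ : ℝ) (Ω : Set ℂ) (P q : ℂ → ℂ → ℂ) : Prop where
  differentiableOn : DifferentiableOn ℂ (fun x : ℂ × ℂ => P x.1 x.2) (Set.univ ×ˢ Ω)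
  differentiableOn_deriv : DifferentiableOn ℂ (fun x : ℂ × ℂ => q x.1 x.2) (Set.univ ×ˢ Ω)
  hasDerivAt : ∀ ω ∈ Ω, ∀ ζ, HasDerivAt (fun ζ => P ζ ω) (q ζ ω) ζ
  asymptotic : ∀ η : ℝ, 0 < η → ∃ X : ℝ, ∀ ζ : ℂ, X ≤ ζ.re → ∀ ω ∈ Ω,
    ‖q ζ ω - Complex.exp (κ * ζ)‖ ≤ η * ‖Complex.exp (κ * ζ)‖

/-- A holomorphic operator-valued function which is `O(z ^ (-1 - δ))` in every sector. -/
structure IsDecaying {n : ℕ} (M δ : ℝ) (Ω : Set ℂ)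
    (R : ℂ → ℂ → (Fin n → ℂ) →L[ℂ] (Fin n → ℂ)) : Prop where
  differentiableOn : DifferentiableOn ℂ (fun x : ℂ × ℂ => R x.1 x.2) (outer M ×ˢ Ω)
  isUniformBigO : ∀ α α' : ℝ, IsUniformBigO Ω α α' (-1 - δ) R

/-- The coefficient of the system `xₖ' = lₖ q xₖ + exp ζ (R x)ₖ`. -/
noncomputable def reducedCoefficient {n : ℕ} (l : Fin n → ℂ) (q : ℂ → ℂ → ℂ)
    (R : ℂ → ℂ → (Fin n → ℂ) →L[ℂ] (Fin n → ℂ)) (ζ ω : ℂ) : (Fin n → ℂ) →L[ℂ] (Fin n → ℂ) :=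
  ContinuousLinearMap.mul ℂ (Fin n → ℂ) (q ζ ω • l) + Complex.exp ζ • R ζ ω

variable {n : ℕ} {M δ κ : ℝ} {Ω : Set ℂ} {P q : ℂ → ℂ → ℂ} {l : Fin n → ℂ}
  {R : ℂ → ℂ → (Fin n → ℂ) →L[ℂ] (Fin n → ℂ)}

theorem reducedCoefficient_apply (l : Fin n → ℂ) (q : ℂ → ℂ → ℂ)
    (R : ℂ → ℂ → (Fin n → ℂ) →L[ℂ] (Fin n → ℂ)) (ζ ω : ℂ) (x : Fin n → ℂ) (k : Fin n) :
    reducedCoefficient l q R ζ ω x k = l k * q ζ ω * x k + Complex.exp ζ * R ζ ω x k := by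
  simp [reducedCoefficient]
  ring

theorem differentiableOn_reducedCoefficient (hP : IsPhase κ Ω P q) (hR : IsDecaying M δ Ω R) :
    DifferentiableOn ℂ (fun x : ℂ × ℂ => reducedCoefficient l q R x.1 x.2) (outer M ×ˢ Ω) := by
  have h1 : DifferentiableOn ℂ (fun x : ℂ × ℂ => q x.1 x.2 • l) (outer M ×ˢ Ω) :=
    (hP.differentiableOn_deriv.mono (Set.prod_mono_left (Set.subset_univ _))).smul_const l
  have h2 : DifferentiableOn ℂ (fun x : ℂ × ℂ => Complex.exp x.1) (outer M ×ˢ Ω) :=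
    Differentiable.differentiableOn (by fun_prop)
  exact ((ContinuousLinearMap.mul ℂ (Fin n → ℂ)).differentiable.comp_differentiableOn h1).add
    (h2.smul hR.differentiableOn)

theorem outer_eq_halfPlane (hM : 0 < M) : outer M = {ζ : ℂ | Real.log M < ζ.re} := by
  ext ζ
  exact (Real.log_lt_iff_lt_exp hM).symm

theorem convex_outer (hM : 0 < M) : Convex ℝ (outer M) := by
  rw [outer_eq_halfPlane hM]
  exact convex_halfSpace_re_gt _

theorem isOpen_outer (M : ℝ) : IsOpen (outer M) :=
  isOpen_lt continuous_const (by unfold modulus; fun_prop)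

theorem norm_exp_eq_modulus (ζ : ℂ) : ‖Complex.exp ζ‖ = modulus ζ := Complex.norm_exp ζ

theorem modulus_pos (ζ : ℂ) : 0 < modulus ζ := Real.exp_pos _

/-- The logarithm of the point `z` for which `u = z ^ κ * exp (-i θ)`. -/
noncomputable def sectorLog (κ θ : ℝ) (u : ℂ) : ℂ := (Complex.log u + θ * Complex.I) / κ

theorem sectorLog_re (κ θ : ℝ) (u : ℂ) : (sectorLog κ θ u).re = Real.log ‖u‖ / κ := by
  simp [sectorLog, Complex.div_ofReal_re, Complex.log_re]

theorem sectorLog_im (κ θ : ℝ) (u : ℂ) : (sectorLog κ θ u).im = (Complex.arg u + θ) / κ := by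
  simp [sectorLog, Complex.div_ofReal_im, Complex.log_im]

theorem modulus_sectorLog (κ θ : ℝ) {u : ℂ} (hu : u ≠ 0) :
    modulus (sectorLog κ θ u) = ‖u‖ ^ (1 / κ) := by
  rw [modulus, sectorLog_re, Real.rpow_def_of_pos (norm_pos_iff.2 hu)]
  ring_nf

theorem exp_mul_sectorLog {κ : ℝ} (hκ : κ ≠ 0) (θ : ℝ) {u : ℂ} (hu : u ≠ 0) :
    Complex.exp (κ * sectorLog κ θ u) = u * Complex.exp (θ * Complex.I) := by
  rw [sectorLog, mul_div_cancel₀ _ (by exact_mod_cast hκ), Complex.exp_add, Complex.exp_log hu]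

theorem hasDerivAt_sectorLog (κ θ : ℝ) {u : ℂ} (hu : u ∈ Complex.slitPlane) :
    HasDerivAt (sectorLog κ θ) ((κ * u)⁻¹) u := by
  have := ((Complex.hasDerivAt_log hu).add_const (θ * Complex.I)).div_const (κ : ℂ)
  convert! this using 1
  rw [mul_inv, mul_comm]; rfl

theorem sectorLog_exp {κ : ℝ} (hκ : κ ≠ 0) {θ : ℝ} {ζ : ℂ} (h1 : -Real.pi < κ * ζ.im - θ)
    (h2 : κ * ζ.im - θ ≤ Real.pi) :
    sectorLog κ θ (Complex.exp (κ * ζ - θ * Complex.I)) = ζ := by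
  rw [sectorLog, Complex.log_exp (by simpa using h1) (by simpa using h2), sub_add_cancel,
    mul_div_cancel_left₀ _ (by exact_mod_cast hκ)]

end ReducedSystem

/-! ### Solving the reduced system on a wedge exterior. -/

section SectorialSolution

open PuncturedCover

variable {n : ℕ} {M δ κ : ℝ} {Ω : Set ℂ} {P q : ℂ → ℂ → ℂ} {l : Fin n → ℂ}
  {R : ℂ → ℂ → (Fin n → ℂ) →L[ℂ] (Fin n → ℂ)}

/-- This is the speed of the exponent along a ray. As Q/u differs from e^{iθ} by at most η, the
margin ‖a‖‖d‖η in the leading part absorbs the error. -/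
theorem re_phase_deriv_nonneg (hκ : 0 < κ) {θ η : ℝ} {u d a Q : ℂ} (hu : u ≠ 0)
    (hQ : ‖Q - u * Complex.exp (θ * Complex.I)‖ ≤ η * ‖u‖)
    (ha : a = 0 ∨ ‖a‖ * ‖d‖ * η ≤ (a * Complex.exp (θ * Complex.I) * d).re) :
    0 ≤ (a * (Q * (κ * u)⁻¹) * d).re := by
  rcases ha with rfl | ha
  · simp
  have hκ' : (κ : ℂ) ≠ 0 := by exact_mod_cast hκ.ne'
  have e1 : a * (Q * (κ * u)⁻¹) * d = ((κ⁻¹ : ℝ) : ℂ) * (a * Complex.exp (θ * Complex.I) * d +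
      a * d * ((Q - u * Complex.exp (θ * Complex.I)) / u)) := by
    push_cast
    field_simp
    ring
  rw [e1, Complex.re_ofReal_mul, Complex.add_re]
  refine mul_nonneg (by positivity) ?_
  have h1 := (neg_abs_le _).trans' (neg_le_neg (Complex.abs_re_le_norm
    (a * d * ((Q - u * Complex.exp (θ * Complex.I)) / u))))
  have h2 : ‖a * d * ((Q - u * Complex.exp (θ * Complex.I)) / u)‖ ≤ ‖a‖ * ‖d‖ * η := by
    rw [norm_mul, norm_mul, norm_div]
    gcongr
    rw [div_le_iff₀ (norm_pos_iff.2 hu)]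
    exact hQ
  linarith

/-- On a wedge exterior in the variable `u = z ^ κ exp (-i θ)` there is a solution of the reduced
system which is asymptotic to a constant vector annihilated by the diagonal part. -/
theorem exists_wedge_solution (hκ : 0 < κ) (hδ : 0 < δ) (hΩ : IsOpen Ω)
    (hP : IsPhase κ Ω P q) (hR : IsDecaying M δ Ω R) (θ : ℝ) (e : Fin n → ℂ)
    (he : ∀ k, l k * e k = 0)
    (hl : ∀ k, l k = 0 ∨ (l k * Complex.exp (θ * Complex.I)).im ≠ 0) :
    ∃ ε N : ℝ, 0 < ε ∧ ε ≤ 1 ∧ 0 < N ∧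
      (∀ u ∈ wedgeExterior ε N, sectorLog κ θ u ∈ outer M) ∧
      ∃ φ : ℂ → ℂ → Fin n → ℂ,
        DifferentiableOn ℂ (fun p : ℂ × ℂ => φ p.1 p.2) (wedgeExterior ε N ×ˢ Ω) ∧
        (∃ C : ℝ, ∀ u ∈ wedgeExterior ε N, ∀ ω ∈ Ω, ‖φ u ω - e‖ ≤ C * ‖u‖ ^ (-(δ / κ))) ∧
        ∀ u ∈ wedgeExterior ε N, ∀ ω ∈ Ω, HasDerivAt (fun u => φ u ω)
          ((κ * u : ℂ)⁻¹ • reducedCoefficient l q R (sectorLog κ θ u) ω (φ u ω)) u := by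
  have hκ' : (κ : ℂ) ≠ 0 := by exact_mod_cast hκ.ne'
  obtain ⟨ε, hε, hε1, d, hd⟩ := exists_ray_directions
    (fun k => l k * Complex.exp (θ * Complex.I)) fun k => (hl k).imp (fun h => by simp [h]) id
  -- η is the relative error of the phase derivative that every ray direction tolerates.
  have hη : ∃ η : ℝ, 0 < η ∧ ∀ k, l k = 0 ∨
      ‖l k‖ * ‖d k‖ * η ≤ (l k * Complex.exp (θ * Complex.I) * d k).re := by
    have h1 : ∀ k, ∀ᶠ η : ℝ in 𝓝[>] 0, l k = 0 ∨
        ‖l k‖ * ‖d k‖ * η ≤ (l k * Complex.exp (θ * Complex.I) * d k).re := by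
      intro k
      rcases (hd k).2 with h | h
      · exact Eventually.of_forall fun _ => Or.inl (by simpa using h)
      · have : Tendsto (fun η : ℝ => ‖l k‖ * ‖d k‖ * η) (𝓝[>] 0) (𝓝 (‖l k‖ * ‖d k‖ * 0)) :=
          (tendsto_id.mono_left nhdsWithin_le_nhds).const_mul _
        rw [mul_zero] at this
        exact (this.eventually_le_const h).mono fun _ => Or.inr
    obtain ⟨η, h, h0⟩ := ((eventually_all.2 h1).and self_mem_nhdsWithin).exists
    exact ⟨η, h0, h⟩
  obtain ⟨η, hη0, hη⟩ := hη
  obtain ⟨X, hX⟩ := hP.asymptotic η hη0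
  -- The principal argument of u ranges in (-π, π], so this one sector contains all the points z
  -- that occur.
  obtain ⟨CR, NR, hCR⟩ := hR.isUniformBigO ((-Real.pi + θ) / κ) ((Real.pi + θ) / κ)
  set C : ℝ := max CR 0 / κ with hC
  have hC0 : 0 ≤ C := by positivity
  set b : ℝ := δ / κ with hb
  have hb0 : 0 < b := by positivity
  set c : ℝ := ε / 16 with hc
  have hc0 : 0 < c := by positivity
  have hpow : Tendsto (fun t : ℝ => t ^ (1 / κ)) atTop atTop := tendsto_rpow_atTop (by positivity)
  have hlarge : ∀ᶠ t : ℝ in atTop, X ≤ Real.log t / κ ∧ NR ≤ t ^ (1 / κ) ∧ M < t ^ (1 / κ) ∧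
      2 * c ^ (-1 - b) / b * C * t ^ (-b) ≤ 1 / 2 := by
    refine ((Real.tendsto_log_atTop.atTop_div_const hκ).eventually_ge_atTop X).and
      ((hpow.eventually_ge_atTop NR).and ((hpow.eventually_gt_atTop M).and ?_))
    have := (tendsto_rpow_neg_atTop hb0).const_mul (2 * c ^ (-1 - b) / b * C)
    rw [mul_zero] at this
    exact this.eventually_le_const (by norm_num)
  obtain ⟨t₀, ht₀⟩ := eventually_atTop.1 hlarge
  -- Membership in the wedge exterior only gives ‖u‖ ≥ N/2, hence the factor 2. The maximum with 1
  -- makes `N` positive.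
  set N : ℝ := 2 * max t₀ 1 with hN
  have hN2 : N / 2 = max t₀ 1 := by rw [hN]; ring
  have hN0 : 0 < N := by positivity
  set D := wedgeExterior ε N with hD
  have hDN : ∀ u ∈ D, N / 2 ≤ ‖u‖ := fun u hu => half_le_norm_of_mem_wedgeExterior hε1 hu
  have hDt : ∀ u ∈ D, t₀ ≤ ‖u‖ := fun u hu => (le_max_left _ _).trans (hN2 ▸ hDN u hu)
  have hslit : ∀ u ∈ D, u ∈ Complex.slitPlane := fun u hu => wedgeExterior_subset_slitPlane hN0 hu
  have hne : ∀ u ∈ D, u ≠ 0 := fun u hu => Complex.slitPlane_ne_zero (hslit u hu)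
  have hout : ∀ u ∈ D, sectorLog κ θ u ∈ outer M := by
    intro u hu
    change M < modulus _
    rw [modulus_sectorLog κ θ (hne u hu)]
    exact (ht₀ _ (hDt u hu)).2.2.1
  have hlogd : ∀ u ∈ D, HasDerivAt (sectorLog κ θ) ((κ * u : ℂ)⁻¹) u := fun u hu =>
    hasDerivAt_sectorLog κ θ (hslit u hu)
  have hlogD : DifferentiableOn ℂ (sectorLog κ θ) D := fun u hu =>
    (hlogd u hu).differentiableAt.differentiableWithinAt
  have hfst : Set.MapsTo (Prod.fst : ℂ × ℂ → ℂ) (D ×ˢ Ω) D := fun p hp => hp.1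
  have hlog2 : DifferentiableOn ℂ (fun p : ℂ × ℂ => ((sectorLog κ θ p.1, p.2) : ℂ × ℂ)) (D ×ˢ Ω) :=
    (hlogD.comp differentiableOn_fst hfst).prodMk differentiableOn_snd
  set m : Fin n → ℂ → ℂ → ℂ := fun k u ω => l k * P (sectorLog κ θ u) ω with hm
  have hmd : ∀ k, ∀ ω ∈ Ω, ∀ u ∈ D, HasDerivAt (fun u => m k u ω)
      (l k * (q (sectorLog κ θ u) ω * (κ * u : ℂ)⁻¹)) u := fun k ω hω u hu =>
    ((hP.hasDerivAt ω hω _).comp u (hlogd u hu)).const_mul (l k)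
  have hmD : ∀ k, DifferentiableOn ℂ (fun p : ℂ × ℂ => m k p.1 p.2) (D ×ˢ Ω) := fun k =>
    (hP.differentiableOn.comp hlog2 fun p hp => ⟨Set.mem_univ _, hp.2⟩).const_mul (l k)
  have hray : ∀ k, ∀ u ∈ D, ∀ s : ℝ, 0 ≤ s → u + s * d k ∈ D := fun k u hu s hs =>
    wedgeExterior_ray hε (hd k).1 hu hs
  have hre : ∀ k, ∀ u ∈ D, ∀ ω ∈ Ω, ∀ s : ℝ, 0 ≤ s → 0 ≤ (m k (u + s * d k) ω - m k u ω).re := by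
    intro k u hu ω hω s hs
    have hline : ∀ t : ℝ, HasDerivAt (fun t : ℝ => u + t * d k) (d k) t := by
      intro t
      have h1 : HasDerivAt (fun t : ℝ => (t : ℂ)) 1 t := Complex.ofRealCLM.hasDerivAt
      simpa using (h1.mul_const (d k)).const_add u
    have hder : ∀ t : ℝ, 0 ≤ t → HasDerivAt (fun t : ℝ => (m k (u + t * d k) ω).re)
        (l k * (q (sectorLog κ θ (u + t * d k)) ω * (κ * (u + t * d k) : ℂ)⁻¹) * d k).re t :=
      fun t ht => by
        have h1 : HasDerivAt (fun t : ℝ => m k (u + t * d k) ω)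
            (l k * (q (sectorLog κ θ (u + t * d k)) ω * (κ * (u + t * d k) : ℂ)⁻¹) * d k) t :=
          HasDerivAt.comp (h₂ := fun u => m k u ω) t (hmd k ω hω _ (hray k u hu t ht)) (hline t)
        exact Complex.reCLM.hasFDerivAt.comp_hasDerivAt t h1
    have hmono : MonotoneOn (fun t : ℝ => (m k (u + t * d k) ω).re) (Set.Ici 0) := by
      refine monotoneOn_of_hasDerivWithinAt_nonneg (convex_Ici 0)
        (fun t ht => (hder t ht).continuousAt.continuousWithinAt)
        (fun t ht => (hder t (interior_subset ht)).hasDerivWithinAt) fun t ht => ?_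
      have hut := hray k u hu t (interior_subset ht)
      refine re_phase_deriv_nonneg hκ (hne _ hut) ?_ (hη k)
      have h2 := hX (sectorLog κ θ (u + t * d k)) (by
        rw [sectorLog_re]; exact (ht₀ _ (hDt _ hut)).1) ω hω
      rw [exp_mul_sectorLog hκ.ne' θ (hne _ hut)] at h2
      simpa [Complex.norm_exp] using h2
    have := hmono (a := 0) (b := s) Set.self_mem_Ici hs hs
    rw [Complex.sub_re, sub_nonneg]
    simpa using this
  set S : ℂ → ℂ → (Fin n → ℂ) →L[ℂ] (Fin n → ℂ) := fun u ω =>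
    (κ * u : ℂ)⁻¹ • (Complex.exp (sectorLog κ θ u) • R (sectorLog κ θ u) ω) with hS
  have hSD : DifferentiableOn ℂ (fun p : ℂ × ℂ => S p.1 p.2) (D ×ˢ Ω) := by
    have h1 : DifferentiableOn ℂ (fun p : ℂ × ℂ => (κ * p.1 : ℂ)⁻¹) (D ×ˢ Ω) := by
      refine DifferentiableOn.inv (by fun_prop) fun p hp => mul_ne_zero hκ' (hne _ hp.1)
    have h2 : DifferentiableOn ℂ (fun p : ℂ × ℂ => Complex.exp (sectorLog κ θ p.1)) (D ×ˢ Ω) :=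
      (hlogD.comp differentiableOn_fst hfst).cexp
    exact h1.smul (h2.smul (hR.differentiableOn.comp hlog2 fun p hp => ⟨hout _ hp.1, hp.2⟩))
  have hSle : ∀ u ∈ D, ∀ ω ∈ Ω, ‖S u ω‖ ≤ C * ‖u‖ ^ (-1 - b) := by
    intro u hu ω hω
    have hu0 : 0 < ‖u‖ := norm_pos_iff.2 (hne u hu)
    set μ := modulus (sectorLog κ θ u) with hμ
    have hμ' : μ = ‖u‖ ^ (1 / κ) := modulus_sectorLog κ θ (hne u hu)
    have hμ0 : 0 < μ := modulus_pos _
    have hRle : ‖R (sectorLog κ θ u) ω‖ ≤ max CR 0 * μ ^ (-1 - δ) := by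
      refine (hCR ω hω _ ?_ ?_ ?_).trans ?_
      · rw [← hμ, hμ']; exact (ht₀ _ (hDt u hu)).2.1
      · rw [argument, sectorLog_im]
        have := Complex.neg_pi_lt_arg u
        gcongr
      · rw [argument, sectorLog_im]
        have := Complex.arg_le_pi u
        gcongr
      · gcongr; exact le_max_left _ _
    have h1 : ‖S u ω‖ = (κ * ‖u‖)⁻¹ * (μ * ‖R (sectorLog κ θ u) ω‖) := by
      rw [hS]
      simp only [norm_smul, norm_exp_eq_modulus, norm_inv, norm_mul, Complex.norm_real,
        Real.norm_of_nonneg hκ.le, ← hμ]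
    -- Here |z|^{-δ} = |u|^{-δ/κ}; the Jacobian 1/(κu) supplies the remaining power of u.
    have h2 : μ * μ ^ (-1 - δ) = ‖u‖ ^ (-b) := by
      rw [← Real.rpow_one_add' hμ0.le (by linarith), hμ', ← Real.rpow_mul hu0.le]
      congr 1
      rw [hb]
      ring
    have h3 : ‖u‖ ^ (-1 - b) = ‖u‖⁻¹ * ‖u‖ ^ (-b) := by
      rw [sub_eq_add_neg, Real.rpow_add hu0, Real.rpow_neg_one]
    rw [h1, h3, ← h2, hC, mul_inv]
    calc κ⁻¹ * ‖u‖⁻¹ * (μ * ‖R (sectorLog κ θ u) ω‖)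
        ≤ κ⁻¹ * ‖u‖⁻¹ * (μ * (max CR 0 * μ ^ (-1 - δ))) := by gcongr
      _ = _ := by ring
  have hdle : ∀ k, ‖d k‖ ≤ 2 := by
    intro k
    have h1 : ‖(ε : ℂ)‖ ≤ 1 := by rwa [Complex.norm_real, Real.norm_of_nonneg hε.le]
    rcases (hd k).1 with h | h <;> rw [h]
    · exact (norm_add_le _ _).trans (by rw [Complex.norm_I]; linarith)
    · exact (norm_sub_le _ _).trans (by rw [Complex.norm_I]; linarith)
  have hd0 : ∀ k, d k ≠ 0 := by
    intro k h0
    have h1 : (d k).re = ε := by rcases (hd k).1 with h | h <;> rw [h] <;> simp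
    rw [h0, Complex.zero_re] at h1
    exact hε.ne h1
  obtain ⟨φ, hφ, hφle, hφd⟩ := exists_ray_solution (isOpen_wedgeExterior ε N) hΩ hdle hd0 hc0 hb0
    hC0 (half_pos hN0) hray
    (fun k u hu s hs => norm_add_ray_ge hε hε1 hN0 (hd k).1 hu hs) hDN hmD hre hSD hSle
    (ht₀ (N / 2) (hN2 ▸ le_max_left _ _)).2.2.2 e
  refine ⟨ε, N, hε, hε1, hN0, hout, φ, hφ, hφle, fun u hu ω hω => hasDerivAt_pi.2 fun k => ?_⟩
  have h1 := hφd u hu ω hω k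
  rw [(hmd k ω hω u hu).deriv] at h1
  convert! h1 using 1
  simp only [hS, Pi.smul_apply, smul_apply, reducedCoefficient_apply, smul_eq_mul]
  -- The Volterra equation has the diagonal part acting on φ - e; `he` removes the contribution of
  -- e.
  linear_combination (q (sectorLog κ θ u) ω * (κ * u : ℂ)⁻¹) * he k

end SectorialSolution

/-! ### Continuation from a wedge exterior to |z| > M, and the asymptotics on a sector of opening
π/κ. -/

section SectorialExtension

open PuncturedCover

theorem convex_setOf_lt_re_add_mul_im (N a : ℝ) : Convex ℝ {u : ℂ | N < u.re + a * u.im} :=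
  convex_halfSpace_gt (f := fun u : ℂ => u.re + a * u.im)
    ⟨fun x y => by simp; ring, fun r x => by simp; ring⟩ N

/-- The domain is not convex, but it is the union of two half-planes which both contain the real
point t. Uniqueness on convex sets applies to each. -/
theorem eq_zero_of_linear_ode_wedgeExterior {E : Type*} [NormedAddCommGroup E] [NormedSpace ℂ E]
    {ε N : ℝ} (hε : 0 < ε) {B : ℂ → E →L[ℂ] E} (hB : ContinuousOn B (wedgeExterior ε N))
    {w : ℂ → E} (hw : ∀ u ∈ wedgeExterior ε N, HasDerivAt w (B u (w u)) u)
    {t : ℝ} (ht : N < t) (h0 : w t = 0) {u : ℂ} (hu : u ∈ wedgeExterior ε N) : w u = 0 := by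
  have hsub : ∀ a : ℝ, |a| = ε / 2 → {u : ℂ | N < u.re + a * u.im} ⊆ wedgeExterior ε N := by
    intro a ha z hz
    have hz' : N < z.re + a * z.im := hz
    have h1 := le_abs_self (a * z.im)
    rw [abs_mul, ha] at h1
    exact hz'.trans_le (by linarith)
  have key : ∀ a : ℝ, |a| = ε / 2 → u ∈ {u : ℂ | N < u.re + a * u.im} → w u = 0 :=
    fun a ha hua => eq_zero_of_linear_ode (convex_setOf_lt_re_add_mul_im N a)
      (hB.mono (hsub a ha)) (fun z hz => hw z (hsub a ha hz))
      (show (t : ℂ) ∈ {u : ℂ | N < u.re + a * u.im} by simpa using ht) h0 hua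
  have hu' : N < u.re + ε / 2 * |u.im| := hu
  rcases abs_cases u.im with ⟨h, _⟩ | ⟨h, _⟩ <;> rw [h] at hu'
  · exact key (ε / 2) (abs_of_pos (by positivity)) hu'
  · refine key (-(ε / 2)) (by rw [abs_neg, abs_of_pos (by positivity)]) ?_
    change N < u.re + -(ε / 2) * u.im
    linarith

variable {n : ℕ} {M δ κ : ℝ} {Ω : Set ℂ} {P q : ℂ → ℂ → ℂ} {l : Fin n → ℂ}
  {R : ℂ → ℂ → (Fin n → ℂ) →L[ℂ] (Fin n → ℂ)}

/-- The reduced system has a solution asymptotic to a constant vector annihilated by the diagonal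
part, in a closed sector of opening `π / κ` whose boundary directions are not oscillatory. -/
theorem exists_sectorial_solution (hM : 0 < M) (hκ : 0 < κ) (hδ : 0 < δ) (hΩ : IsOpen Ω)
    (hP : IsPhase κ Ω P q) (hR : IsDecaying M δ Ω R) (σ : ℝ) (e : Fin n → ℂ)
    (he : ∀ k, l k * e k = 0)
    (hl : ∀ k, l k = 0 ∨ (l k * Complex.exp (Complex.I * σ)).re ≠ 0) :
    ∃ x : ℂ → ℂ → Fin n → ℂ, IsHolomorphic M Ω x ∧
      (∀ ω ∈ Ω, ∀ ζ ∈ outer M,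
        HasDerivAt (fun ζ => x ζ ω) (reducedCoefficient l q R ζ ω (x ζ ω)) ζ) ∧
      IsUniformBigO Ω (σ / κ) ((σ + Real.pi) / κ) (-δ) (fun ζ ω => x ζ ω - e) := by
  have hκ' : (κ : ℂ) ≠ 0 := by exact_mod_cast hκ.ne'
  -- θ is the bisecting direction of the sector. The quarter turn also converts Re(l e^{iσ}) ≠ 0
  -- into the condition Im(l e^{iθ}) ≠ 0 on the wedge.
  set θ : ℝ := σ + Real.pi / 2 with hθ
  have hexp : Complex.exp (θ * Complex.I) = Complex.exp (Complex.I * σ) * Complex.I := by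
    rw [hθ]
    push_cast
    rw [add_mul, Complex.exp_add, Complex.exp_pi_div_two_mul_I, mul_comm (σ : ℂ)]
  obtain ⟨ε, N, hε, hε1, hN, hout, φ, hφ, ⟨C, hC⟩, hφd⟩ :=
    exists_wedge_solution hκ hδ hΩ hP hR θ e he fun k => (hl k).imp id fun h => by
      rw [hexp, ← mul_assoc, Complex.mul_I_im]; exact h
  have hslit : ∀ u ∈ wedgeExterior ε N, u ∈ Complex.slitPlane := fun u hu =>
    wedgeExterior_subset_slitPlane hN hu
  have hne : ∀ u ∈ wedgeExterior ε N, u ≠ 0 := fun u hu => Complex.slitPlane_ne_zero (hslit u hu)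
  have hu₀ : ((N + 1 : ℝ) : ℂ) ∈ wedgeExterior ε N := by
    change N < _ + _ * |_|
    simp
  set u₀ : ℂ := ((N + 1 : ℝ) : ℂ) with hu₀_def
  have hcoef := differentiableOn_reducedCoefficient (l := l) hP hR
  obtain ⟨x, hxd, hx⟩ := exists_linear_ode_solution (convex_outer hM) (isOpen_outer M) hΩ hcoef
    (hout u₀ hu₀) (y₀ := fun ω => φ u₀ ω) (hφ.right_of_prod (g := φ) hu₀)
  refine ⟨x, hxd, fun ω hω => (hx ω hω).2, ?_⟩
  have hagree : ∀ ω ∈ Ω, ∀ u ∈ wedgeExterior ε N, x (sectorLog κ θ u) ω = φ u ω := by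
    intro ω hω u hu
    have hlogd : ∀ u ∈ wedgeExterior ε N, HasDerivAt (sectorLog κ θ) ((κ * u : ℂ)⁻¹) u :=
      fun u hu => hasDerivAt_sectorLog κ θ (hslit u hu)
    refine sub_eq_zero.1 (eq_zero_of_linear_ode_wedgeExterior hε
      (B := fun u => (κ * u : ℂ)⁻¹ • reducedCoefficient l q R (sectorLog κ θ u) ω)
      (w := fun u => x (sectorLog κ θ u) ω - φ u ω) ?_ ?_ (lt_add_one N) ?_ hu)
    · refine ContinuousOn.smul (ContinuousOn.inv₀ (by fun_prop) fun u hu =>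
        mul_ne_zero hκ' (hne u hu)) ?_
      exact (hcoef.left_of_prod (g := reducedCoefficient l q R) hω).continuousOn.comp
        (fun u hu => (hlogd u hu).continuousAt.continuousWithinAt) hout
    · intro u hu
      have h1 := ((hx ω hω).2 _ (hout u hu)).scomp u (hlogd u hu)
      have h2 := h1.sub (hφd u hu ω hω)
      rw [← smul_sub, ← map_sub] at h2
      exact h2
    · exact sub_eq_zero.2 (hx ω hω).1
  have hrpow : Tendsto (fun t : ℝ => t ^ κ) atTop atTop := tendsto_rpow_atTop hκ
  -- If Re u ≥ 0, then Re u + (ε/2)|Im u| ≥ (ε/2)‖u‖ because ε ≤ 1, so ‖u‖ > 2N/ε puts u in the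
  -- domain.
  obtain ⟨N', hN'⟩ := eventually_atTop.1 (hrpow.eventually_gt_atTop (2 * N / ε))
  refine ⟨C, N', fun ω hω ζ hζ h1 h2 => ?_⟩
  set u : ℂ := Complex.exp (κ * ζ - θ * Complex.I) with hu
  have hnorm : ‖u‖ = modulus ζ ^ κ := by
    rw [hu, Complex.norm_exp, modulus, ← Real.exp_mul]
    simp [mul_comm]
  have h1' : -(Real.pi / 2) ≤ κ * ζ.im - θ := by
    rw [div_le_iff₀ hκ] at h1
    simp only [argument] at h1
    rw [hθ]; linarith
  have h2' : κ * ζ.im - θ ≤ Real.pi / 2 := by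
    rw [le_div_iff₀ hκ] at h2
    simp only [argument] at h2
    rw [hθ]; linarith
  have hre : 0 ≤ u.re := by
    rw [hu, Complex.exp_re]
    refine mul_nonneg (Real.exp_pos _).le (Real.cos_nonneg_of_mem_Icc ⟨?_, ?_⟩)
    · simpa using h1'
    · simpa using h2'
  have hmem : u ∈ wedgeExterior ε N := by
    change N < u.re + ε / 2 * |u.im|
    have h3 := Complex.norm_le_abs_re_add_abs_im u
    rw [abs_of_nonneg hre] at h3
    have h4 := hN' _ hζ
    rw [← hnorm, div_lt_iff₀ hε] at h4
    nlinarith [abs_nonneg u.im]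
  have hlog : sectorLog κ θ u = ζ :=
    sectorLog_exp hκ.ne' (by linarith [Real.pi_pos]) (by linarith [Real.pi_pos])
  have h5 := hC u hmem ω hω
  rw [← hagree ω hω u hmem, hlog, hnorm, ← Real.rpow_mul (modulus_pos ζ).le] at h5
  convert h5 using 3
  field_simp

end SectorialExtension

/-! ### Solutions decaying along a ray. -/

section Uniqueness

open PuncturedCover

variable {n : ℕ} {M δ κ : ℝ} {Ω : Set ℂ} {P q : ℂ → ℂ → ℂ} {l : Fin n → ℂ}
  {R : ℂ → ℂ → (Fin n → ℂ) →L[ℂ] (Fin n → ℂ)}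

/-- `x` solves the reduced system on `|z| > M` at the parameter `ω`. -/
def IsReducedSolution (M : ℝ) (l : Fin n → ℂ) (q : ℂ → ℂ → ℂ)
    (R : ℂ → ℂ → (Fin n → ℂ) →L[ℂ] (Fin n → ℂ)) (ω : ℂ) (x : ℂ → Fin n → ℂ) : Prop :=
  ∀ ζ ∈ outer M, HasDerivAt x (reducedCoefficient l q R ζ ω (x ζ)) ζ

theorem IsReducedSolution.sub {ω : ℂ} {x y : ℂ → Fin n → ℂ} (hx : IsReducedSolution M l q R ω x)
    (hy : IsReducedSolution M l q R ω y) :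
    IsReducedSolution M l q R ω (fun ζ => x ζ - y ζ) := by
  intro ζ hζ
  have := (hx ζ hζ).fun_sub (hy ζ hζ)
  rwa [← map_sub] at this

theorem IsReducedSolution.sum {ω : ℂ} {Y : Fin n → ℂ → Fin n → ℂ}
    (hY : ∀ j, IsReducedSolution M l q R ω (Y j)) (a : Fin n → ℂ) :
    IsReducedSolution M l q R ω (fun ζ => ∑ j, a j • Y j ζ) := by
  intro ζ hζ
  have := HasDerivAt.fun_sum (u := Finset.univ) fun j _ => (hY j ζ hζ).fun_const_smul (a j)
  simpa [map_sum] using this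

/-- Multiplication by `exp (μ P)` shifts the diagonal part of the reduced system. -/
theorem IsReducedSolution.gauge {ω : ℂ} (hω : ω ∈ Ω) (hP : IsPhase κ Ω P q) {x : ℂ → Fin n → ℂ}
    (hx : IsReducedSolution M l q R ω x) (μ : ℂ) {l' : Fin n → ℂ} (hl' : ∀ k, l' k = μ + l k) :
    IsReducedSolution M l' q R ω (fun ζ => Complex.exp (μ * P ζ ω) • x ζ) := by
  intro ζ hζ
  have h1 := ((hP.hasDerivAt ω hω ζ).const_mul μ).cexp.fun_smul (hx ζ hζ)
  convert! h1 using 1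
  ext k
  simp only [reducedCoefficient_apply, Pi.add_apply, Pi.smul_apply, smul_eq_mul, map_smul, hl' k]
  ring

theorem IsReducedSolution.eq_zero {ω : ℂ} (hM : 0 < M) (hω : ω ∈ Ω) (hP : IsPhase κ Ω P q)
    (hR : IsDecaying M δ Ω R) {x : ℂ → Fin n → ℂ} (hx : IsReducedSolution M l q R ω x) {ζ₀ : ℂ}
    (hζ₀ : ζ₀ ∈ outer M) (h0 : x ζ₀ = 0) {ζ : ℂ} (hζ : ζ ∈ outer M) : x ζ = 0 :=
  eq_zero_of_linear_ode (convex_outer hM)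
    ((differentiableOn_reducedCoefficient (l := l) hP hR).left_of_prod
      (g := reducedCoefficient l q R) hω).continuousOn hx hζ₀ h0 hζ

theorem modulus_ray (t θ : ℝ) : modulus (t + θ * Complex.I : ℂ) = Real.exp t := by
  simp [modulus]

theorem argument_ray (t θ : ℝ) : argument (t + θ * Complex.I : ℂ) = θ := by
  simp [argument]

theorem eventually_ray_mem_outer (M θ : ℝ) :
    ∀ᶠ t : ℝ in atTop, (t + θ * Complex.I : ℂ) ∈ outer M :=
  (Real.tendsto_exp_atTop.eventually_gt_atTop M).mono fun t ht => by
    change M < modulus _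
    rwa [modulus_ray]

theorem hasDerivAt_ray (θ t : ℝ) : HasDerivAt (fun t : ℝ => (t + θ * Complex.I : ℂ)) 1 t :=
  HasDerivAt.add_const _ Complex.ofRealCLM.hasDerivAt

theorem PuncturedCover.IsUniformBigO.tendsto_ray {E : Type*} [NormedAddCommGroup E] {α α' : ℝ}
    {f : PuncturedCover → ℂ → E} (hδ : 0 < δ) (hf : IsUniformBigO Ω α α' (-δ) f) {ω : ℂ}
    (hω : ω ∈ Ω) {θ : ℝ} (h1 : α ≤ θ) (h2 : θ ≤ α') :
    Tendsto (fun t : ℝ => f (t + θ * Complex.I) ω) atTop (𝓝 0) := by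
  obtain ⟨C, N, hC⟩ := hf
  have h3 : Tendsto (fun t : ℝ => C * Real.exp t ^ (-δ)) atTop (𝓝 0) := by
    have := ((tendsto_rpow_neg_atTop hδ).comp Real.tendsto_exp_atTop).const_mul C
    simpa using this
  refine squeeze_zero_norm' ?_ h3
  filter_upwards [Real.tendsto_exp_atTop.eventually_ge_atTop N] with t ht
  have := hC ω hω (t + θ * Complex.I) (by rwa [modulus_ray]) (by rwa [argument_ray])
    (by rwa [argument_ray])
  rwa [modulus_ray] at this

/-- On the ray q has asymptotic direction e^{iκθ}, so Re(a q) inherits the sign of its leading part.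
Consequently Re(a P) is nondecreasing far out, with a threshold independent of ω. -/
theorem exists_forall_re_mul_deriv_nonneg (hP : IsPhase κ Ω P q) {θ : ℝ} {a : ℂ}
    (ha : a = 0 ∨ 0 < (a * Complex.exp (Complex.I * (κ * θ : ℝ))).re) :
    ∃ X : ℝ, ∀ t : ℝ, X ≤ t → ∀ ω ∈ Ω, 0 ≤ (a * q (t + θ * Complex.I) ω).re := by
  rcases ha with rfl | ha
  · exact ⟨0, fun t _ ω _ => by simp⟩
  have ha0 : 0 < ‖a‖ := by
    rw [norm_pos_iff]
    rintro rfl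
    simp at ha
  set r := (a * Complex.exp (Complex.I * (κ * θ : ℝ))).re with hr
  obtain ⟨X, hX⟩ := hP.asymptotic (r / ‖a‖) (by positivity)
  refine ⟨X, fun t ht ω hω => ?_⟩
  have h1 := hX (t + θ * Complex.I) (by simpa using ht) ω hω
  have h2 : Complex.exp (κ * (t + θ * Complex.I)) =
      ((Real.exp (κ * t) : ℝ) : ℂ) * Complex.exp (Complex.I * (κ * θ : ℝ)) := by
    push_cast
    rw [← Complex.exp_add]
    ring_nf
  have h3 : ‖Complex.exp (κ * (t + θ * Complex.I))‖ = Real.exp (κ * t) := by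
    rw [Complex.norm_exp]; simp
  rw [h3] at h1
  set Q := q (t + θ * Complex.I) ω
  have h4 : (a * Q).re = Real.exp (κ * t) * r +
      (a * (Q - Complex.exp (κ * (t + θ * Complex.I)))).re := by
    rw [hr, ← Complex.re_ofReal_mul, ← Complex.add_re, h2]
    ring_nf
  have h5 : ‖a * (Q - Complex.exp (κ * (t + θ * Complex.I)))‖ ≤ r * Real.exp (κ * t) := by
    rw [norm_mul]
    calc _ ≤ ‖a‖ * (r / ‖a‖ * Real.exp (κ * t)) := by gcongr
      _ = _ := by field_simp
  have h6 := (neg_abs_le _).trans' (neg_le_neg (Complex.abs_re_le_norm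
    (a * (Q - Complex.exp (κ * (t + θ * Complex.I))))))
  rw [h4]
  linarith

/-- A solution of the reduced system which tends to zero along a ray on which the diagonal part
does not decay vanishes identically. -/
theorem IsReducedSolution.eq_zero_of_tendsto_ray {ω : ℂ} (hM : 0 < M) (hδ : 0 < δ) (hω : ω ∈ Ω)
    (hP : IsPhase κ Ω P q) (hR : IsDecaying M δ Ω R) {x : ℂ → Fin n → ℂ}
    (hx : IsReducedSolution M l q R ω x) {θ : ℝ}
    (hl : ∀ k, l k = 0 ∨ 0 < (l k * Complex.exp (Complex.I * (κ * θ : ℝ))).re)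
    (h0 : Tendsto (fun t : ℝ => x (t + θ * Complex.I)) atTop (𝓝 0)) {ζ : ℂ} (hζ : ζ ∈ outer M) :
    x ζ = 0 := by
  choose X hX using fun k => exists_forall_re_mul_deriv_nonneg hP (hl k)
  obtain ⟨C₀, N, hC₀⟩ := hR.isUniformBigO θ θ
  set C : ℝ := max C₀ 0
  have hlarge : ∀ᶠ t : ℝ in atTop, (∀ k, X k ≤ t) ∧ N ≤ Real.exp t ∧
      (t + θ * Complex.I : ℂ) ∈ outer M :=
    (eventually_all.2 fun k => eventually_ge_atTop (X k)).and
      ((Real.tendsto_exp_atTop.eventually_ge_atTop N).and (eventually_ray_mem_outer M θ))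
  obtain ⟨T, hT⟩ := eventually_atTop.1 hlarge
  set γ : ℝ → ℂ := fun t => t + θ * Complex.I with hγ
  set K : ℝ := 2 * n * C with hK
  -- the energy and its damped version
  set E : ℝ → ℝ := fun t => ∑ k, ‖x (γ t) k‖ ^ 2 with hE
  set x' : ℝ → Fin n → ℂ := fun t => reducedCoefficient l q R (γ t) ω (x (γ t)) with hx'
  have hxd : ∀ t, T ≤ t → HasDerivAt (fun t => x (γ t)) (x' t) t := by
    intro t ht
    have := (hx _ (hT t ht).2.2).scomp t (hasDerivAt_ray θ t)
    rw [one_smul] at this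
    exact this
  have hEd : ∀ t, T ≤ t → HasDerivAt E (∑ k, 2 * inner ℝ (x (γ t) k) (x' t k)) t := fun t ht =>
    HasDerivAt.fun_sum fun k _ => (hasDerivAt_pi.1 (hxd t ht) k).norm_sq
  have hE0 : ∀ t, 0 ≤ E t := fun t => Finset.sum_nonneg fun k _ => by positivity
  have hxE : ∀ t, ‖x (γ t)‖ ^ 2 ≤ E t := by
    intro t
    have h1 : ‖x (γ t)‖ ≤ √(E t) := by
      refine (pi_norm_le_iff_of_nonneg (Real.sqrt_nonneg _)).2 fun k => Real.le_sqrt_of_sq_le ?_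
      exact Finset.single_le_sum (f := fun k => ‖x (γ t) k‖ ^ 2) (fun k _ => by positivity)
        (Finset.mem_univ k)
    calc ‖x (γ t)‖ ^ 2 ≤ √(E t) ^ 2 := by gcongr
      _ = E t := Real.sq_sqrt (hE0 t)
  -- The diagonal part can only increase the energy. The remainder lowers it at a relative rate at
  -- most K e^{-δt}, which is integrable.
  have hEle : ∀ t, T ≤ t →
      -(K * Real.exp (-δ * t) * E t) ≤ ∑ k, 2 * inner ℝ (x (γ t) k) (x' t k) := by
    intro t ht
    obtain ⟨hXt, hNt, -⟩ := hT t ht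
    have hRle : ‖R (γ t) ω‖ ≤ C * Real.exp t ^ (-1 - δ) := by
      have := hC₀ ω hω (γ t) (by rwa [modulus_ray]) (argument_ray t θ).ge (argument_ray t θ).le
      rw [modulus_ray] at this
      exact this.trans (by gcongr; exact le_max_left _ _)
    have hpow : Real.exp t * Real.exp t ^ (-1 - δ) = Real.exp (-δ * t) := by
      rw [← Real.exp_mul, ← Real.exp_add]
      ring_nf
    have hterm : ∀ k, -(2 * C * Real.exp (-δ * t) * E t) ≤
        2 * inner ℝ (x (γ t) k) (x' t k) := by
      intro k
      have e1 : inner ℝ (x (γ t) k) (x' t k) = (l k * q (γ t) ω).re * ‖x (γ t) k‖ ^ 2 +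
          inner ℝ (x (γ t) k) (Complex.exp (γ t) * R (γ t) ω (x (γ t)) k) := by
        rw [hx']
        simp only [reducedCoefficient_apply, inner_add_right]
        congr 1
        rw [Complex.inner, mul_assoc _ (x (γ t) k), Complex.mul_conj, Complex.normSq_eq_norm_sq,
          Complex.re_mul_ofReal]
      have e2 := mul_nonneg (hX k t (hXt k) ω hω) (sq_nonneg ‖x (γ t) k‖)
      have e3 : |inner ℝ (x (γ t) k) (Complex.exp (γ t) * R (γ t) ω (x (γ t)) k)| ≤
          C * Real.exp (-δ * t) * E t := by
        refine (abs_real_inner_le_norm _ _).trans ?_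
        rw [norm_mul, norm_exp_eq_modulus, modulus_ray]
        calc ‖x (γ t) k‖ * (Real.exp t * ‖R (γ t) ω (x (γ t)) k‖)
            ≤ ‖x (γ t)‖ * (Real.exp t * (C * Real.exp t ^ (-1 - δ) * ‖x (γ t)‖)) := by
              gcongr
              · exact norm_le_pi_norm _ k
              · exact (norm_le_pi_norm _ k).trans (((R (γ t) ω).le_opNorm _).trans (by gcongr))
          _ = C * (Real.exp t * Real.exp t ^ (-1 - δ)) * ‖x (γ t)‖ ^ 2 := by ring
          _ ≤ C * Real.exp (-δ * t) * E t := by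
              rw [hpow]
              have := hxE t
              gcongr
      have e4 := neg_le_of_abs_le e3
      rw [e1]
      linarith
    calc -(K * Real.exp (-δ * t) * E t) = ∑ k : Fin n, -(2 * C * Real.exp (-δ * t) * E t) := by
          simp [hK]; ring
      _ ≤ _ := Finset.sum_le_sum fun k _ => hterm k
  -- The integrating factor compensates for the rate K e^{-δt} and stays at most 1. Thus W is
  -- nonnegative, nondecreasing and tends to 0, which forces E(T) = 0.
  set W : ℝ → ℝ := fun t => E t * Real.exp (-(K / δ * Real.exp (-δ * t))) with hW
  have hWd : ∀ t, T ≤ t → HasDerivAt W ((∑ k, 2 * inner ℝ (x (γ t) k) (x' t k)) *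
      Real.exp (-(K / δ * Real.exp (-δ * t))) + E t *
      (Real.exp (-(K / δ * Real.exp (-δ * t))) * (K * Real.exp (-δ * t)))) t := by
    intro t ht
    have h1 : HasDerivAt (fun t : ℝ => -(K / δ * Real.exp (-δ * t))) (K * Real.exp (-δ * t)) t := by
      have h2 := ((((hasDerivAt_id t).const_mul (-δ)).exp).const_mul (K / δ)).fun_neg
      convert! h2 using 1
      simp
      field_simp
    exact (hEd t ht).mul h1.exp
  have hmono : MonotoneOn W (Set.Ici T) := by
    refine monotoneOn_of_hasDerivWithinAt_nonneg (convex_Ici T)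
      (fun t ht => (hWd t ht).continuousAt.continuousWithinAt)
      (fun t ht => (hWd t (interior_subset ht)).hasDerivWithinAt) fun t ht => ?_
    have h1 := hEle t (interior_subset ht)
    have h2 := Real.exp_pos (-(K / δ * Real.exp (-δ * t)))
    nlinarith
  have hW0 : Tendsto W atTop (𝓝 0) := by
    have h1 : Tendsto E atTop (𝓝 0) := by
      have : Tendsto (fun t => ∑ k, ‖x (γ t) k‖ ^ 2) atTop (𝓝 (∑ _k : Fin n, ‖(0 : ℂ)‖ ^ 2)) :=
        tendsto_finsetSum _ fun k _ => ((tendsto_pi_nhds.1 h0 k).norm.pow 2)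
      simpa using this
    refine squeeze_zero (fun t => by have := hE0 t; positivity) (fun t => ?_) h1
    refine mul_le_of_le_one_right (hE0 t) (Real.exp_le_one_iff.2 ?_)
    have : 0 ≤ K / δ * Real.exp (-δ * t) := by positivity
    linarith
  have hWT : W T ≤ 0 := by
    refine ge_of_tendsto hW0 ?_
    filter_upwards [eventually_ge_atTop T] with t ht using hmono Set.self_mem_Ici ht ht
  have hET : E T ≤ 0 := by
    by_contra! h
    have := mul_pos h (Real.exp_pos (-(K / δ * Real.exp (-δ * T))))
    exact absurd hWT (not_le.2 this)
  have hxT : x (γ T) = 0 := by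
    have := (hxE T).trans hET
    have h2 : ‖x (γ T)‖ ^ 2 = 0 := le_antisymm this (by positivity)
    exact norm_eq_zero.1 (pow_eq_zero_iff two_ne_zero |>.1 h2)
  exact hx.eq_zero hM hω hP hR (hT T le_rfl).2.2 hxT hζ

end Uniqueness

/-! ### Linear independence and vanishing coefficients read off along a ray. -/

section SolutionBasis

open PuncturedCover

variable {n : ℕ} {M δ κ : ℝ} {Ω : Set ℂ} {P q : ℂ → ℂ → ℂ} {ν : Fin n → ℂ}
  {R : ℂ → ℂ → (Fin n → ℂ) →L[ℂ] (Fin n → ℂ)}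

/-- Vectors which are close to the standard basis control their coefficients. -/
theorem eventually_norm_le_two_mul_norm_sum {w : Fin n → ℝ → Fin n → ℂ}
    (hw : ∀ j, Tendsto (fun t => w j t - Pi.single j 1) atTop (𝓝 0)) :
    ∀ᶠ t in atTop, ∀ a : Fin n → ℂ, ‖a‖ ≤ 2 * ‖∑ j, a j • w j t‖ := by
  have h1 : Tendsto (fun t => ∑ j, ‖w j t - Pi.single j 1‖) atTop (𝓝 0) := by
    have : Tendsto (fun t => ∑ j, ‖w j t - Pi.single j 1‖) atTop
        (𝓝 (∑ _j : Fin n, ‖(0 : Fin n → ℂ)‖)) :=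
      tendsto_finsetSum _ fun j _ => (hw j).norm
    simpa using this
  filter_upwards [h1.eventually_le_const (show (0 : ℝ) < 1 / 2 by norm_num)] with t ht a
  have h2 : a = ∑ j, a j • w j t - ∑ j, a j • (w j t - Pi.single j 1) := by
    rw [← Finset.sum_sub_distrib]
    ext k
    simp [Finset.sum_apply, Pi.single_apply, mul_sub]
  have h3 : ‖∑ j, a j • (w j t - Pi.single j 1)‖ ≤ ‖a‖ * (1 / 2) := by
    calc _ ≤ ∑ j, ‖a‖ * ‖w j t - Pi.single j 1‖ := by
          refine norm_sum_le_of_le _ fun j _ => ?_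
          rw [norm_smul]
          gcongr
          exact norm_le_pi_norm a j
      _ ≤ ‖a‖ * (1 / 2) := by rw [← Finset.mul_sum]; gcongr
  have h4 := norm_sub_le (∑ j, a j • w j t) (∑ j, a j • (w j t - Pi.single j 1))
  rw [← h2] at h4
  linarith

/-- Solutions which are asymptotic to the standard exponentials along one ray form a basis of the
space of solutions. -/
theorem existsUnique_coefficients {ω : ℂ} (hM : 0 < M) (hω : ω ∈ Ω) (hP : IsPhase κ Ω P q)
    (hR : IsDecaying M δ Ω R) {Y : Fin n → ℂ → Fin n → ℂ}
    (hY : ∀ j, IsReducedSolution M (fun k => -ν k) q R ω (Y j)) {θ : ℝ}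
    (hlim : ∀ j, Tendsto (fun t : ℝ => Complex.exp (ν j * P (t + θ * Complex.I) ω) •
      Y j (t + θ * Complex.I) - Pi.single j 1) atTop (𝓝 0))
    {y : ℂ → Fin n → ℂ} (hy : IsReducedSolution M (fun k => -ν k) q R ω y) :
    ∃! a : Fin n → ℂ, ∀ ζ ∈ outer M, y ζ = ∑ j, a j • Y j ζ := by
  obtain ⟨t, ht, hout⟩ := ((eventually_norm_le_two_mul_norm_sum hlim).and
    (eventually_ray_mem_outer M θ)).exists
  set ζ₀ : ℂ := t + θ * Complex.I with hζ₀
  set Λ : (Fin n → ℂ) →ₗ[ℂ] (Fin n → ℂ) := Fintype.linearCombination ℂ fun j => Y j ζ₀ with hΛ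
  have hΛa : ∀ a, Λ a = ∑ j, a j • Y j ζ₀ := fun a => Fintype.linearCombination_apply ..
  have hinj : Function.Injective Λ := by
    rw [← LinearMap.ker_eq_bot, LinearMap.ker_eq_bot']
    intro a ha
    -- The exponentials have very different sizes, so they are moved into the coefficients before
    -- comparison with the standard basis.
    have h1 := ht fun j => a j * Complex.exp (-(ν j * P ζ₀ ω))
    have h2 : ∑ j, (a j * Complex.exp (-(ν j * P ζ₀ ω))) • (Complex.exp (ν j * P ζ₀ ω) • Y j ζ₀) =
        Λ a := by
      rw [hΛa]
      refine Finset.sum_congr rfl fun j _ => ?_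
      rw [smul_smul, mul_assoc, ← Complex.exp_add, neg_add_cancel, Complex.exp_zero, mul_one]
    rw [h2, ha, norm_zero, mul_zero, norm_le_zero_iff] at h1
    ext j
    have h3 := congrFun h1 j
    simpa using h3
  obtain ⟨a, ha⟩ := LinearMap.injective_iff_surjective.1 hinj (y ζ₀)
  refine ⟨a, fun ζ hζ => ?_, fun a' ha' => hinj ?_⟩
  · refine sub_eq_zero.1 ((hy.sub (IsReducedSolution.sum hY a)).eq_zero hM hω hP hR hout ?_ hζ)
    rw [← ha, hΛa, sub_self]
  · rw [ha, hΛa, ← ha' ζ₀ hout]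

/-- A coefficient with respect to the solution basis vanishes if the solution is smaller than the
corresponding exponential along a ray. -/
theorem coefficient_eq_zero_of_tendsto_ray {ω : ℂ} (hω : ω ∈ Ω) (hP : IsPhase κ Ω P q)
    {Y : Fin n → ℂ → Fin n → ℂ} {θ : ℝ}
    (hlim : ∀ j, Tendsto (fun t : ℝ => Complex.exp (ν j * P (t + θ * Complex.I) ω) •
      Y j (t + θ * Complex.I) - Pi.single j 1) atTop (𝓝 0))
    {y : ℂ → Fin n → ℂ} {a : Fin n → ℂ} (ha : ∀ ζ ∈ outer M, y ζ = ∑ j, a j • Y j ζ) {μ : ℂ}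
    (h0 : Tendsto (fun t : ℝ => Complex.exp (μ * P (t + θ * Complex.I) ω) •
      y (t + θ * Complex.I)) atTop (𝓝 0)) {k : Fin n}
    (hk : μ - ν k = 0 ∨ 0 < ((μ - ν k) * Complex.exp (Complex.I * (κ * θ : ℝ))).re) :
    a k = 0 := by
  obtain ⟨X, hX⟩ := exists_forall_re_mul_deriv_nonneg hP hk
  set γ : ℝ → ℂ := fun t => t + θ * Complex.I with hγ
  -- Monotonicity bounds |exp((μ - ν_k) P)| below by a positive constant along the ray. A nonzero
  -- coefficient would then keep exp(μP) y away from 0.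
  have hmono : MonotoneOn (fun t => ((μ - ν k) * P (γ t) ω).re) (Set.Ici X) := by
    have hd : ∀ t, HasDerivAt (fun t => ((μ - ν k) * P (γ t) ω).re)
        ((μ - ν k) * q (γ t) ω).re t := by
      intro t
      have h1 : HasDerivAt (fun t => (μ - ν k) * P (γ t) ω) ((μ - ν k) * (q (γ t) ω * 1)) t :=
        (HasDerivAt.comp (h₂ := fun ζ => P ζ ω) t (hP.hasDerivAt ω hω (γ t))
          (hasDerivAt_ray θ t)).const_mul (μ - ν k)
      rw [mul_one] at h1
      exact Complex.reCLM.hasFDerivAt.comp_hasDerivAt t h1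
    exact monotoneOn_of_hasDerivWithinAt_nonneg (convex_Ici X)
      (fun t _ => (hd t).continuousAt.continuousWithinAt)
      (fun t _ => (hd t).hasDerivWithinAt) fun t ht => hX t (interior_subset ht) ω hω
  set r := Real.exp ((μ - ν k) * P (γ X) ω).re with hr
  have hr0 : 0 < r := Real.exp_pos _
  have hle : ∀ᶠ t in atTop, ‖a k‖ * r ≤ 2 * ‖Complex.exp (μ * P (γ t) ω) • y (γ t)‖ := by
    filter_upwards [eventually_norm_le_two_mul_norm_sum hlim, eventually_ray_mem_outer M θ,
      eventually_ge_atTop X] with t ht hout hXt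
    have h1 : ‖fun j => a j * Complex.exp ((μ - ν j) * P (γ t) ω)‖ ≤
        2 * ‖∑ j, (a j * Complex.exp ((μ - ν j) * P (γ t) ω)) •
          (Complex.exp (ν j * P (γ t) ω) • Y j (γ t))‖ :=
      ht fun j => a j * Complex.exp ((μ - ν j) * P (γ t) ω)
    have h2 : ∑ j, (a j * Complex.exp ((μ - ν j) * P (γ t) ω)) •
        (Complex.exp (ν j * P (γ t) ω) • Y j (γ t)) = Complex.exp (μ * P (γ t) ω) • y (γ t) := by
      rw [ha _ hout, Finset.smul_sum]
      refine Finset.sum_congr rfl fun j _ => ?_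
      rw [smul_smul, smul_smul, mul_assoc, ← Complex.exp_add, mul_comm (a j), ← add_mul,
        sub_add_cancel]
    rw [h2] at h1
    refine le_trans ?_ h1
    refine le_trans ?_ (norm_le_pi_norm _ k)
    rw [norm_mul, Complex.norm_exp]
    gcongr
    exact Real.exp_le_exp.2 (hmono Set.self_mem_Ici hXt hXt)
  have hlim0 : Tendsto (fun t => 2 * ‖Complex.exp (μ * P (γ t) ω) • y (γ t)‖) atTop (𝓝 0) := by
    simpa using h0.norm.const_mul 2
  have h3 : ‖a k‖ * r ≤ 0 := ge_of_tendsto hlim0 hle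
  have h4 : ‖a k‖ ≤ 0 := by
    by_contra! h
    exact absurd h3 (not_le.2 (mul_pos h hr0))
  exact norm_le_zero_iff.1 h4

end SolutionBasis

/-! ### Gluing solutions with common leading terms into wider sectors. -/

section Gluing

open PuncturedCover

namespace PuncturedCover.IsUniformBigO

variable {E : Type*} [NormedAddCommGroup E] {Ω : Set ℂ} {α α' s : ℝ}
  {f g : PuncturedCover → ℂ → E}

theorem union {α₁ α₁' : ℝ} (hf : IsUniformBigO Ω α α' s f) (hf₁ : IsUniformBigO Ω α₁ α₁' s f)
    (h : α₁ ≤ α') : IsUniformBigO Ω α α₁' s f := by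
  obtain ⟨C, N, hC⟩ := hf
  obtain ⟨C₁, N₁, hC₁⟩ := hf₁
  refine ⟨max C C₁, max N N₁, fun ω hω ζ hζ h1 h2 => ?_⟩
  have h0 : 0 ≤ modulus ζ ^ s := Real.rpow_nonneg (modulus_pos ζ).le _
  rcases le_total (argument ζ) α' with h3 | h3
  · exact (hC ω hω ζ ((le_max_left _ _).trans hζ) h1 h3).trans
      (mul_le_mul_of_nonneg_right (le_max_left _ _) h0)
  · exact (hC₁ ω hω ζ ((le_max_right _ _).trans hζ) (h.trans h3) h2).trans
      (mul_le_mul_of_nonneg_right (le_max_right _ _) h0)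

theorem congr_outer {M : ℝ} (hf : IsUniformBigO Ω α α' s f)
    (h : ∀ ζ ∈ outer M, ∀ ω ∈ Ω, g ζ ω = f ζ ω) : IsUniformBigO Ω α α' s g := by
  obtain ⟨C, N, hC⟩ := hf
  refine ⟨C, max N (M + 1), fun ω hω ζ hζ h1 h2 => ?_⟩
  rw [h ζ ((lt_add_one M).trans_le ((le_max_right _ _).trans hζ)) ω hω]
  exact hC ω hω ζ ((le_max_left _ _).trans hζ) h1 h2

end PuncturedCover.IsUniformBigO

variable {n : ℕ} {M δ κ : ℝ} {Ω : Set ℂ} {P q : ℂ → ℂ → ℂ} {ν : Fin n → ℂ}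
  {R : ℂ → ℂ → (Fin n → ℂ) →L[ℂ] (Fin n → ℂ)}

/-- `y = (e + O(z ^ (-δ))) exp (-μ P)` in a closed sector, uniformly in the parameter. -/
def HasLeadingTerm (Ω : Set ℂ) (P : ℂ → ℂ → ℂ) (δ α α' : ℝ) (μ : ℂ) (e : Fin n → ℂ)
    (y : ℂ → ℂ → Fin n → ℂ) : Prop :=
  IsUniformBigO Ω α α' (-δ) (fun ζ ω => Complex.exp (μ * P ζ ω) • y ζ ω - e)

theorem HasLeadingTerm.tendsto_sub {α₁ α₁' α₂ α₂' θ : ℝ} {μ ω : ℂ} {e : Fin n → ℂ}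
    {y₁ y₂ : ℂ → ℂ → Fin n → ℂ} (hδ : 0 < δ) (hω : ω ∈ Ω)
    (h₁ : HasLeadingTerm Ω P δ α₁ α₁' μ e y₁) (h₂ : HasLeadingTerm Ω P δ α₂ α₂' μ e y₂)
    (hθ₁ : θ ∈ Set.Icc α₁ α₁') (hθ₂ : θ ∈ Set.Icc α₂ α₂') :
    Tendsto (fun t : ℝ => Complex.exp (μ * P (t + θ * Complex.I) ω) •
      (y₁ (t + θ * Complex.I) ω - y₂ (t + θ * Complex.I) ω)) atTop (𝓝 0) := by
  have h3 := (IsUniformBigO.tendsto_ray hδ h₁ hω hθ₁.1 hθ₁.2).sub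
    (IsUniformBigO.tendsto_ray hδ h₂ hω hθ₂.1 hθ₂.2)
  simpa [smul_sub] using h3

/-- Two solutions with the same leading term agree if they can be compared along a ray on which
the leading exponential is subdominant. -/
theorem eq_of_subdominant_ray (hM : 0 < M) (hδ : 0 < δ) (hP : IsPhase κ Ω P q)
    (hR : IsDecaying M δ Ω R) {α₁ α₁' α₂ α₂' θ : ℝ} {μ ω : ℂ} {e : Fin n → ℂ}
    {y₁ y₂ : ℂ → ℂ → Fin n → ℂ} (hω : ω ∈ Ω)
    (hy₁ : IsReducedSolution M (fun k => -ν k) q R ω (fun ζ => y₁ ζ ω))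
    (hy₂ : IsReducedSolution M (fun k => -ν k) q R ω (fun ζ => y₂ ζ ω))
    (h₁ : HasLeadingTerm Ω P δ α₁ α₁' μ e y₁) (h₂ : HasLeadingTerm Ω P δ α₂ α₂' μ e y₂)
    (hθ₁ : θ ∈ Set.Icc α₁ α₁') (hθ₂ : θ ∈ Set.Icc α₂ α₂')
    (hν : ∀ k, μ - ν k = 0 ∨ 0 < ((μ - ν k) * Complex.exp (Complex.I * (κ * θ : ℝ))).re)
    {ζ : ℂ} (hζ : ζ ∈ outer M) : y₁ ζ ω = y₂ ζ ω := by
  have h3 := ((hy₁.sub hy₂).gauge hω hP μ (l' := fun k => μ - ν k) fun k =>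
    sub_eq_add_neg _ _).eq_zero_of_tendsto_ray hM hδ hω hP hR hν
      (HasLeadingTerm.tendsto_sub hδ hω h₁ h₂ hθ₁ hθ₂) hζ
  exact sub_eq_zero.1 ((smul_eq_zero.1 h3).resolve_left (Complex.exp_ne_zero _))

/-- Two families of solutions with the standard leading terms agree if they can be compared along
two rays such that each exponential is subdominant to every other one on one of these rays. -/
theorem eq_of_two_rays (hM : 0 < M) (hδ : 0 < δ) (hP : IsPhase κ Ω P q)
    (hR : IsDecaying M δ Ω R) {α₁ α₁' α₂ α₂' θ θ' : ℝ} {ω : ℂ}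
    {Y₁ Y₂ : Fin n → ℂ → ℂ → Fin n → ℂ} (hω : ω ∈ Ω)
    (hY₁ : ∀ j, IsReducedSolution M (fun k => -ν k) q R ω (fun ζ => Y₁ j ζ ω))
    (hY₂ : ∀ j, IsReducedSolution M (fun k => -ν k) q R ω (fun ζ => Y₂ j ζ ω))
    (h₁ : ∀ j, HasLeadingTerm Ω P δ α₁ α₁' (ν j) (Pi.single j 1) (Y₁ j))
    (h₂ : ∀ j, HasLeadingTerm Ω P δ α₂ α₂' (ν j) (Pi.single j 1) (Y₂ j))
    (hθ₁ : θ ∈ Set.Icc α₁ α₁') (hθ₂ : θ ∈ Set.Icc α₂ α₂')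
    (hθ₁' : θ' ∈ Set.Icc α₁ α₁') (hθ₂' : θ' ∈ Set.Icc α₂ α₂')
    (hν : ∀ j k, ν j - ν k = 0 ∨ 0 < ((ν j - ν k) * Complex.exp (Complex.I * (κ * θ : ℝ))).re ∨
      0 < ((ν j - ν k) * Complex.exp (Complex.I * (κ * θ' : ℝ))).re)
    (j : Fin n) {ζ : ℂ} (hζ : ζ ∈ outer M) : Y₂ j ζ ω = Y₁ j ζ ω := by
  have hlim : ∀ φ ∈ Set.Icc α₁ α₁', ∀ j, Tendsto (fun t : ℝ =>
      Complex.exp (ν j * P (t + φ * Complex.I) ω) • Y₁ j (t + φ * Complex.I) ω - Pi.single j 1)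
      atTop (𝓝 0) := fun φ hφ j => IsUniformBigO.tendsto_ray hδ (h₁ j) hω hφ.1 hφ.2
  obtain ⟨a, ha, -⟩ := existsUnique_coefficients hM hω hP hR (Y := fun j ζ => Y₁ j ζ ω) hY₁
    (hlim θ hθ₁) ((hY₂ j).sub (hY₁ j))
  have ha0 : ∀ k, a k = 0 := by
    intro k
    have key : ∀ φ ∈ Set.Icc α₁ α₁', φ ∈ Set.Icc α₂ α₂' → (ν j - ν k = 0 ∨
        0 < ((ν j - ν k) * Complex.exp (Complex.I * (κ * φ : ℝ))).re) → a k = 0 :=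
      fun φ hφ₁ hφ₂ hk => by
        have h0 := HasLeadingTerm.tendsto_sub hδ hω (h₂ j) (h₁ j) hφ₂ hφ₁
        exact coefficient_eq_zero_of_tendsto_ray (Y := fun j ζ => Y₁ j ζ ω)
          (y := fun ζ => Y₂ j ζ ω - Y₁ j ζ ω) hω hP (hlim φ hφ₁) ha h0 hk
    rcases hν j k with h | h | h
    · exact key θ hθ₁ hθ₂ (Or.inl h)
    · exact key θ hθ₁ hθ₂ (Or.inr h)
    · exact key θ' hθ₁' hθ₂' (Or.inr h)
  have h3 := ha ζ hζ
  simp only [ha0, zero_smul, Finset.sum_const_zero] at h3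
  exact sub_eq_zero.1 h3

/-- No direction in `[a, b]` is oscillatory for any pair of distinct eigenvalues. -/
def IsSeparating (ν : Fin n → ℂ) (a b : ℝ) : Prop :=
  ∀ τ ∈ Set.Icc a b, ∀ j j' : Fin n,
    ((ν j - ν j') * Complex.exp (Complex.I * τ)).re = 0 ↔ ν j = ν j'

theorem exp_I_mul_add_pi (τ : ℝ) :
    Complex.exp (Complex.I * (τ + Real.pi : ℝ)) = -Complex.exp (Complex.I * τ) := by
  push_cast
  rw [mul_add, Complex.exp_add, mul_comm Complex.I (Real.pi : ℂ), Complex.exp_pi_mul_I]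
  ring

theorem exp_I_mul_sub_pi (τ : ℝ) :
    Complex.exp (Complex.I * (τ - Real.pi : ℝ)) = -Complex.exp (Complex.I * τ) := by
  have := exp_I_mul_add_pi (τ - Real.pi)
  rw [sub_add_cancel] at this
  rw [this, neg_neg]

/-- By the intermediate value theorem Re((ν_j - ν_k) e^{iτ}) has constant sign on [a, b] when the
eigenvalues differ. If it is positive, the direction τ serves; if negative, adding π to τ' reverses
the sign. -/
theorem IsSeparating.subdominant {a b τ τ' : ℝ} (h : IsSeparating ν a b) (hτ : τ ∈ Set.Icc a b)
    (hτ' : τ' ∈ Set.Icc a b) (j k : Fin n) :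
    ν j - ν k = 0 ∨ 0 < ((ν j - ν k) * Complex.exp (Complex.I * τ)).re ∨
      0 < ((ν j - ν k) * Complex.exp (Complex.I * (τ' + Real.pi : ℝ))).re := by
  by_cases hjk : ν j = ν k
  · exact Or.inl (sub_eq_zero.2 hjk)
  refine Or.inr ?_
  rw [exp_I_mul_add_pi, mul_neg, Complex.neg_re, neg_pos]
  by_contra! hcon
  have hcont : ContinuousOn (fun s : ℝ => ((ν j - ν k) * Complex.exp (Complex.I * s)).re)
      (Set.Icc a b) := by fun_prop
  obtain ⟨s, hs, hs0⟩ := isPreconnected_Icc.intermediate_value hτ hτ' hcont ⟨hcon.1, hcon.2⟩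
  exact hjk ((h s hs j k).1 hs0)

/-- After the gauge exp(ν_j P) the j-th diagonal entry is zero, so the j-th basis vector is an
admissible limit at infinity. -/
theorem exists_leading_solution (hM : 0 < M) (hκ : 0 < κ) (hδ : 0 < δ) (hΩ : IsOpen Ω)
    (hP : IsPhase κ Ω P q) (hR : IsDecaying M δ Ω R) (σ : ℝ) (j : Fin n)
    (hν : ∀ k, ν j - ν k = 0 ∨ ((ν j - ν k) * Complex.exp (Complex.I * σ)).re ≠ 0) :
    ∃ y : ℂ → ℂ → Fin n → ℂ, IsHolomorphic M Ω y ∧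
      (∀ ω ∈ Ω, IsReducedSolution M (fun k => -ν k) q R ω (fun ζ => y ζ ω)) ∧
      HasLeadingTerm Ω P δ (σ / κ) ((σ + Real.pi) / κ) (ν j) (Pi.single j 1) y := by
  obtain ⟨x, hxd, hx, hxO⟩ := exists_sectorial_solution (l := fun k => ν j - ν k) hM hκ hδ hΩ hP hR
    σ (Pi.single j 1) (fun k => by
      rcases eq_or_ne k j with rfl | hk
      · simp
      · simp [hk]) hν
  refine ⟨fun ζ ω => Complex.exp (-ν j * P ζ ω) • x ζ ω, ?_, fun ω hω => ?_, ?_⟩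
  · have h1 : DifferentiableOn ℂ (fun p : ℂ × ℂ => P p.1 p.2) (outer M ×ˢ Ω) :=
      hP.differentiableOn.mono (Set.prod_mono_left (Set.subset_univ _))
    exact (h1.const_mul (-ν j)).cexp.smul hxd
  · exact IsReducedSolution.gauge (l := fun k => ν j - ν k) hω hP (hx ω hω) (-ν j)
      fun k => by ring
  · refine IsUniformBigO.congr_outer (M := M) hxO fun ζ _ ω _ => ?_
    rw [smul_smul, ← Complex.exp_add, neg_mul, add_neg_cancel, Complex.exp_zero, one_smul]

/-- The family of solutions of the first kind, in coordinates. -/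
theorem exists_leading_family (hM : 0 < M) (hκ : 0 < κ) (hδ : 0 < δ) (hΩ : IsOpen Ω)
    (hP : IsPhase κ Ω P q) (hR : IsDecaying M δ Ω R) {a b : ℝ} (hab : a ≤ b)
    (hν : IsSeparating ν a b) :
    ∃ Y : Fin n → ℂ → ℂ → Fin n → ℂ, (∀ j, IsHolomorphic M Ω (Y j)) ∧
      (∀ ω ∈ Ω, ∀ j, IsReducedSolution M (fun k => -ν k) q R ω (fun ζ => Y j ζ ω)) ∧
      ∀ j, HasLeadingTerm Ω P δ (a / κ) ((b + Real.pi) / κ) (ν j) (Pi.single j 1) (Y j) := by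
  have hbase : ∀ σ ∈ Set.Icc a b, ∃ Y : Fin n → ℂ → ℂ → Fin n → ℂ,
      (∀ j, IsHolomorphic M Ω (Y j)) ∧
      (∀ ω ∈ Ω, ∀ j, IsReducedSolution M (fun k => -ν k) q R ω (fun ζ => Y j ζ ω)) ∧
      ∀ j, HasLeadingTerm Ω P δ (σ / κ) ((σ + Real.pi) / κ) (ν j) (Pi.single j 1) (Y j) := by
    intro σ hσ
    choose Y hYd hY hYO using fun j => exists_leading_solution (ν := ν) hM hκ hδ hΩ hP hR σ j
      fun k => by
        rw [or_iff_not_imp_left, sub_eq_zero]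
        exact fun h h0 => h ((hν σ hσ j k).1 h0)
    exact ⟨Y, hYd, fun ω hω j => hY j ω hω, hYO⟩
  -- Sectors of angular width π (in κ arg z) are chained with base directions at most π apart, so
  -- that consecutive ones meet. If two eigenvalues differ then b - a < π and one gluing suffices;
  -- further steps concern only the case where all eigenvalues are equal.
  have hind : ∀ m : ℕ, ∀ b' ∈ Set.Icc a b, b' ≤ a + m * Real.pi →
      ∃ Y : Fin n → ℂ → ℂ → Fin n → ℂ, (∀ j, IsHolomorphic M Ω (Y j)) ∧
      (∀ ω ∈ Ω, ∀ j, IsReducedSolution M (fun k => -ν k) q R ω (fun ζ => Y j ζ ω)) ∧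
      ∀ j, HasLeadingTerm Ω P δ (a / κ) ((b' + Real.pi) / κ) (ν j) (Pi.single j 1) (Y j) := by
    intro m
    induction m with
    | zero =>
      intro b' hb' hle
      have : b' = a := le_antisymm (by simpa using hle) hb'.1
      rw [this]
      exact hbase a ⟨le_rfl, hab⟩
    | succ m ih =>
      intro b' hb' hle
      have hπ := Real.pi_pos
      push_cast at hle
      have hc : max a (b' - Real.pi) ∈ Set.Icc a b :=
        ⟨le_max_left _ _, max_le hab (by linarith [hb'.2])⟩
      have hc1 : max a (b' - Real.pi) ≤ b' := max_le hb'.1 (by linarith)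
      have hc2 : b' ≤ max a (b' - Real.pi) + Real.pi := by linarith [le_max_right a (b' - Real.pi)]
      obtain ⟨Y₁, hd₁, hY₁, h₁⟩ := ih _ hc
        (max_le (by have : (0 : ℝ) ≤ m * Real.pi := by positivity
                    linarith) (by linarith))
      set c := max a (b' - Real.pi)
      obtain ⟨Y₂, hd₂, hY₂, h₂⟩ := hbase b' hb'
      refine ⟨Y₁, hd₁, hY₁, fun j => IsUniformBigO.union (h₁ j) ?_
        (show b' / κ ≤ (c + Real.pi) / κ by gcongr)⟩
      refine IsUniformBigO.congr_outer (M := M) (h₂ j) fun ζ hζ ω hω => ?_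
      have heq : Y₂ j ζ ω = Y₁ j ζ ω := by
        -- These rays are the two edges of the overlap of the sectors, and κ arg z there is b' and c
        -- + π, the two kinds of direction covered by `IsSeparating.subdominant`.
        refine eq_of_two_rays (θ := b' / κ) (θ' := (c + Real.pi) / κ) hM hδ hP hR hω (hY₁ ω hω)
          (hY₂ ω hω) h₁ h₂ ?_ ?_ ?_ ?_ ?_ j hζ
        · exact ⟨by have := hb'.1; gcongr, by gcongr⟩
        · exact ⟨le_rfl, by gcongr; linarith⟩
        · exact ⟨by gcongr; linarith [hc.1], le_rfl⟩
        · exact ⟨by gcongr, by gcongr⟩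
        · intro j k
          rw [mul_div_cancel₀ _ hκ.ne', mul_div_cancel₀ _ hκ.ne']
          exact hν.subdominant hb' hc j k
      rw [heq]
  obtain ⟨m, hm⟩ := exists_nat_ge ((b - a) / Real.pi)
  refine hind m b ⟨hab, le_rfl⟩ ?_
  rw [div_le_iff₀ Real.pi_pos] at hm
  linarith

/-- The solution which is subdominant for `[a, b]`, in coordinates. -/
theorem exists_subdominant_solution (hM : 0 < M) (hκ : 0 < κ) (hδ : 0 < δ) (hΩ : IsOpen Ω)
    (hP : IsPhase κ Ω P q) (hR : IsDecaying M δ Ω R) {a b : ℝ} (hab : a ≤ b) (j : Fin n)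
    (hν : ∀ τ ∈ Set.Icc a b, ∀ k, ν j - ν k = 0 ∨
      0 < ((ν j - ν k) * Complex.exp (Complex.I * τ)).re) :
    ∃ y : ℂ → ℂ → Fin n → ℂ, IsHolomorphic M Ω y ∧
      (∀ ω ∈ Ω, IsReducedSolution M (fun k => -ν k) q R ω (fun ζ => y ζ ω)) ∧
      HasLeadingTerm Ω P δ ((a - Real.pi) / κ) ((b + Real.pi) / κ) (ν j) (Pi.single j 1) y := by
  have hπ := Real.pi_pos
  have hray : ∀ σ ∈ Set.Icc a b, ∀ k, ν j - ν k = 0 ∨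
      0 < ((ν j - ν k) * Complex.exp (Complex.I * (κ * (σ / κ) : ℝ))).re := by
    intro σ hσ k
    rw [mul_div_cancel₀ _ hκ.ne']
    exact hν σ hσ k
  have hbase : ∀ σ ∈ Set.Icc a b, ∃ y : ℂ → ℂ → Fin n → ℂ, IsHolomorphic M Ω y ∧
      (∀ ω ∈ Ω, IsReducedSolution M (fun k => -ν k) q R ω (fun ζ => y ζ ω)) ∧
      HasLeadingTerm Ω P δ ((σ - Real.pi) / κ) ((σ + Real.pi) / κ) (ν j) (Pi.single j 1) y := by
    intro σ hσ
    -- The sectors based at σ - π and σ share exactly the ray κ arg z = σ. The exponential is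
    -- subdominant there, which is enough to identify the two solutions and double the opening.
    obtain ⟨y₁, hd₁, hy₁, h₁⟩ := exists_leading_solution (ν := ν) hM hκ hδ hΩ hP hR (σ - Real.pi) j
      fun k => (hν σ hσ k).imp id fun h => by
        rw [exp_I_mul_sub_pi, mul_neg, Complex.neg_re]
        exact neg_ne_zero.2 h.ne'
    obtain ⟨y₂, hd₂, hy₂, h₂⟩ := exists_leading_solution (ν := ν) hM hκ hδ hΩ hP hR σ j
      fun k => (hν σ hσ k).imp id fun h => h.ne'
    rw [sub_add_cancel] at h₁
    refine ⟨y₁, hd₁, hy₁, IsUniformBigO.union h₁ ?_ le_rfl⟩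
    refine IsUniformBigO.congr_outer (M := M) h₂ fun ζ hζ ω hω => ?_
    rw [eq_of_subdominant_ray hM hδ hP hR hω (hy₁ ω hω) (hy₂ ω hω) h₁ h₂ (θ := σ / κ)
      ⟨by gcongr; linarith, le_rfl⟩ ⟨le_rfl, by gcongr; linarith⟩ (hray σ hσ) hζ]
  -- The same chaining, now comparing along the single ray κ arg z = b', which lies in both sectors.
  have hind : ∀ m : ℕ, ∀ b' ∈ Set.Icc a b, b' ≤ a + m * Real.pi →
      ∃ y : ℂ → ℂ → Fin n → ℂ, IsHolomorphic M Ω y ∧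
      (∀ ω ∈ Ω, IsReducedSolution M (fun k => -ν k) q R ω (fun ζ => y ζ ω)) ∧
      HasLeadingTerm Ω P δ ((a - Real.pi) / κ) ((b' + Real.pi) / κ) (ν j) (Pi.single j 1) y := by
    intro m
    induction m with
    | zero =>
      intro b' hb' hle
      have : b' = a := le_antisymm (by simpa using hle) hb'.1
      rw [this]
      exact hbase a ⟨le_rfl, hab⟩
    | succ m ih =>
      intro b' hb' hle
      push_cast at hle
      have hc : max a (b' - Real.pi) ∈ Set.Icc a b :=
        ⟨le_max_left _ _, max_le hab (by linarith [hb'.2])⟩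
      have hc2 : b' ≤ max a (b' - Real.pi) + Real.pi := by linarith [le_max_right a (b' - Real.pi)]
      obtain ⟨y₁, hd₁, hy₁, h₁⟩ := ih _ hc
        (max_le (by have : (0 : ℝ) ≤ m * Real.pi := by positivity
                    linarith) (by linarith))
      set c := max a (b' - Real.pi)
      obtain ⟨y₂, hd₂, hy₂, h₂⟩ := hbase b' hb'
      refine ⟨y₁, hd₁, hy₁, IsUniformBigO.union h₁ ?_
        (show (b' - Real.pi) / κ ≤ (c + Real.pi) / κ by gcongr; linarith)⟩
      refine IsUniformBigO.congr_outer (M := M) h₂ fun ζ hζ ω hω => ?_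
      rw [eq_of_subdominant_ray hM hδ hP hR hω (hy₁ ω hω) (hy₂ ω hω) h₁ h₂ (θ := b' / κ)
        ⟨by gcongr; linarith [hb'.1], by gcongr⟩ ⟨by gcongr; linarith, by gcongr; linarith⟩
        (hray b' hb') hζ]
  obtain ⟨m, hm⟩ := exists_nat_ge ((b - a) / Real.pi)
  refine hind m b ⟨hab, le_rfl⟩ ?_
  rw [div_le_iff₀ Real.pi_pos] at hm
  linarith

end Gluing

/-! ### From the matrix equation in z to the reduced system in eigenbasis coordinates. -/

section Translation

open PuncturedCover

namespace PuncturedCover.IsUniformBigO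

variable {Ω : Set ℂ} {α α' s : ℝ}

theorem pi {ι : Type*} [Fintype ι] {E : Type*} [NormedAddCommGroup E]
    {f : PuncturedCover → ℂ → ι → E}
    (hf : ∀ i, IsUniformBigO Ω α α' s (fun ζ ω => f ζ ω i)) : IsUniformBigO Ω α α' s f := by
  choose C N hC using hf
  refine ⟨∑ i, |C i|, ∑ i, |N i|, fun ω hω ζ hζ h1 h2 => ?_⟩
  have h0 : 0 ≤ modulus ζ ^ s := Real.rpow_nonneg (modulus_pos ζ).le _
  refine (pi_norm_le_iff_of_nonneg (by positivity)).2 fun i => ?_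
  have hN : |N i| ≤ ∑ i, |N i| :=
    Finset.single_le_sum (f := fun i => |N i|) (fun i _ => abs_nonneg _) (Finset.mem_univ i)
  have hCi : |C i| ≤ ∑ i, |C i| :=
    Finset.single_le_sum (f := fun i => |C i|) (fun i _ => abs_nonneg _) (Finset.mem_univ i)
  exact (hC i ω hω ζ ((le_abs_self _).trans (hN.trans hζ)) h1 h2).trans
    (mul_le_mul_of_nonneg_right ((le_abs_self _).trans hCi) h0)

theorem clm_apply {E F : Type*} [NormedAddCommGroup E] [NormedSpace ℂ E] [NormedAddCommGroup F]
    [NormedSpace ℂ F] {f : PuncturedCover → ℂ → E} (hf : IsUniformBigO Ω α α' s f)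
    (L : E →L[ℂ] F) : IsUniformBigO Ω α α' s (fun ζ ω => L (f ζ ω)) := by
  obtain ⟨C, N, hC⟩ := hf
  refine ⟨‖L‖ * C, N, fun ω hω ζ hζ h1 h2 => (L.le_opNorm _).trans ?_⟩
  rw [mul_assoc]
  exact mul_le_mul_of_nonneg_left (hC ω hω ζ hζ h1 h2) (norm_nonneg _)

end PuncturedCover.IsUniformBigO

theorem proj_mul_power (ζ : ℂ) (b : ℝ) : proj ζ * power ζ b = power ζ (b + 1) := by
  rw [proj, power, power, logarithm, ← Complex.exp_add]
  push_cast
  ring_nf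

theorem hasDerivAt_power (ζ : ℂ) (b : ℝ) :
    HasDerivAt (fun ζ => power ζ b) ((b : ℂ) * power ζ b) ζ := by
  have := ((hasDerivAt_id ζ).const_mul (b : ℂ)).cexp
  simpa [power, logarithm, mul_comm] using this

theorem hasDerivAt_power_div (ζ : ℂ) {b : ℝ} (hb : b + 1 ≠ 0) :
    HasDerivAt (fun ζ => power ζ (b + 1) / ((b + 1 : ℝ) : ℂ)) (power ζ (b + 1)) ζ := by
  have := (hasDerivAt_power ζ (b + 1)).div_const ((b + 1 : ℝ) : ℂ)
  rwa [mul_div_cancel_left₀ _ (by exact_mod_cast hb)] at this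

theorem norm_power (ζ : ℂ) (b : ℝ) : ‖power ζ b‖ = Real.exp (b * ζ.re) := by
  rw [power, Complex.norm_exp, logarithm, Complex.re_ofReal_mul]

theorem proj_mul_leading (H : ℕ) (β : ℕ → ℝ) (c : ℕ → ℂ → ℂ) (ζ ω : ℂ) :
    proj ζ * leading H β c ζ ω =
      power ζ (β 0 + 1) + ∑ k ∈ Finset.Icc 1 H, c k ω * power ζ (β k + 1) := by
  rw [leading, mul_add, proj_mul_power, Finset.mul_sum]
  congr 1
  refine Finset.sum_congr rfl fun k _ => ?_
  rw [← proj_mul_power]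
  ring

variable {H : ℕ} {β : ℕ → ℝ} {c : ℕ → ℂ → ℂ} {Ω : Set ℂ}

theorem differentiable_power (b : ℝ) : Differentiable ℂ (fun x : ℂ × ℂ => power x.1 b) := by
  unfold power logarithm
  fun_prop

theorem differentiable_power_div (b : ℝ) (d : ℂ) :
    Differentiable ℂ (fun x : ℂ × ℂ => power x.1 b / d) := by
  simp only [div_eq_mul_inv]
  exact (differentiable_power b).mul_const d⁻¹

/-- All exponents before the last exceed -1, so their powers integrate to powers; the exponent -1
gives the logarithm, whose ζ-derivative is 1. Boundedness of the c_k makes the dominance of the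
leading power uniform in ω. -/
theorem isPhase_primitive (hH : 1 ≤ H) (hβ : StrictAntiOn β (Set.Iic H)) (hβH : β H = -1)
    (hc : ∀ k ∈ Finset.Icc 1 H, DifferentiableOn ℂ (c k) Ω ∧ ∃ B : ℝ, ∀ ω ∈ Ω, ‖c k ω‖ ≤ B) :
    IsPhase (β 0 + 1) Ω (primitive H β c) (fun ζ ω => proj ζ * leading H β c ζ ω) := by
  have hβ0 : ∀ k, k < H → β k + 1 ≠ 0 := fun k hk => by
    have := hβ (Set.mem_Iic.2 hk.le) (Set.mem_Iic.2 le_rfl) hk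
    rw [hβH] at this
    linarith
  have hcd : ∀ k ∈ Finset.Icc 1 H,
      DifferentiableOn ℂ (fun x : ℂ × ℂ => c k x.2) (Set.univ ×ˢ Ω) := fun k hk =>
    (hc k hk).1.comp differentiableOn_snd fun x hx => hx.2
  refine ⟨?_, ?_, fun ω hω ζ => ?_, fun η hη => ?_⟩
  · unfold primitive
    refine DifferentiableOn.add (DifferentiableOn.add ?_ (DifferentiableOn.fun_sum fun k hk => ?_)) ?_
    · exact (differentiable_power_div _ _).differentiableOn
    · have hk' : k ∈ Finset.Icc 1 H := Finset.Ico_subset_Icc_self hk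
      exact (hcd k hk').mul (differentiable_power_div _ _).differentiableOn
    · exact (hcd H (Finset.right_mem_Icc.2 hH)).mul differentiableOn_fst
  · simp only [proj_mul_leading]
    refine DifferentiableOn.add (differentiable_power _).differentiableOn
      (DifferentiableOn.fun_sum fun k hk => ?_)
    exact (hcd k hk).mul (differentiable_power _).differentiableOn
  · rw [proj_mul_leading, ← Finset.sum_Ico_add_eq_sum_Icc hH, hβH, ← add_assoc]
    refine HasDerivAt.add (HasDerivAt.add (hasDerivAt_power_div ζ (hβ0 0 hH))
      (HasDerivAt.fun_sum fun k hk => ?_)) ?_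
    · exact (hasDerivAt_power_div ζ (hβ0 k (Finset.mem_Ico.1 hk).2)).const_mul (c k ω)
    · have h1 : power ζ (-1 + 1) = 1 := by simp [power]
      rw [h1]
      exact (hasDerivAt_id ζ).const_mul (c H ω)
  · choose! B hB using fun k hk => (hc k hk).2
    have hlim : Tendsto (fun x : ℝ => ∑ k ∈ Finset.Icc 1 H, |B k| * Real.exp ((β k - β 0) * x))
        atTop (𝓝 (∑ k ∈ Finset.Icc 1 H, |B k| * 0)) := by
      refine tendsto_finsetSum _ fun k hk => Tendsto.const_mul _ ?_
      have hk' := Finset.mem_Icc.1 hk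
      have := hβ (Set.mem_Iic.2 (Nat.zero_le H)) (Set.mem_Iic.2 hk'.2) hk'.1
      exact Real.tendsto_exp_atBot.comp (tendsto_id.const_mul_atTop_of_neg (by linarith))
    simp only [mul_zero, Finset.sum_const_zero] at hlim
    obtain ⟨X, hX⟩ := eventually_atTop.1 (hlim.eventually_le_const hη)
    refine ⟨X, fun ζ hζ ω hω => ?_⟩
    have h1 : Complex.exp ((β 0 + 1 : ℝ) * ζ) = power ζ (β 0 + 1) := rfl
    rw [proj_mul_leading, h1, add_sub_cancel_left, norm_power]
    refine le_trans (norm_sum_le_of_le (n := fun k =>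
      |B k| * Real.exp ((β k - β 0) * ζ.re) * Real.exp ((β 0 + 1) * ζ.re)) _ fun k hk => ?_) ?_
    · rw [norm_mul, norm_power, mul_assoc, ← Real.exp_add]
      have h2 : (β k - β 0) * ζ.re + (β 0 + 1) * ζ.re = (β k + 1) * ζ.re := by ring
      rw [h2]
      gcongr
      exact (hB k hk ω hω).trans (le_abs_self _)
    · rw [← Finset.sum_mul]
      gcongr
      exact hX _ hζ

variable {n : ℕ}

/-- A matrix acting on coordinate vectors with respect to a basis of `ℂⁿ`. -/
noncomputable def conjMulVec (v : Module.Basis (Fin n) ℂ (Fin n → ℂ)) :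
    (Fin n → Fin n → ℂ) →ₗ[ℂ] ((Fin n → ℂ) →L[ℂ] (Fin n → ℂ)) :=
  (LinearMap.toContinuousLinearMap : ((Fin n → ℂ) →ₗ[ℂ] (Fin n → ℂ)) ≃ₗ[ℂ] _).toLinearMap ∘ₗ
    v.equivFun.conj.toLinearMap ∘ₗ Matrix.toLin'.toLinearMap ∘ₗ
      (Matrix.ofLinearEquiv ℂ).toLinearMap

theorem conjMulVec_apply (v : Module.Basis (Fin n) ℂ (Fin n → ℂ)) (B : Matrix (Fin n) (Fin n) ℂ)
    (x : Fin n → ℂ) : conjMulVec v B x = v.equivFun (B.mulVec (v.equivFun.symm x)) := by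
  change v.equivFun (Matrix.toLin' B (v.equivFun.symm x)) = _
  rw [Matrix.toLin'_apply]

theorem isDecaying_conjMulVec {M δ : ℝ} (v : Module.Basis (Fin n) ℂ (Fin n → ℂ))
    {R : PuncturedCover → ℂ → Matrix (Fin n) (Fin n) ℂ}
    (hRhol : ∀ i j, IsHolomorphic M Ω (fun ζ ω => R ζ ω i j))
    (hRdecay : ∀ α α' : ℝ, ∀ i j, IsUniformBigO Ω α α' (-1 - δ) (fun ζ ω => R ζ ω i j)) :
    IsDecaying M δ Ω (fun ζ ω => conjMulVec v (R ζ ω)) := by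
  refine ⟨?_, fun α α' => ?_⟩
  · have h1 : DifferentiableOn ℂ (fun x : ℂ × ℂ => (fun i j => R x.1 x.2 i j : Fin n → Fin n → ℂ))
        (outer M ×ˢ Ω) :=
      differentiableOn_pi.2 fun i => differentiableOn_pi.2 fun j => hRhol i j
    exact (conjMulVec v).toContinuousLinearMap.differentiable.comp_differentiableOn h1
  · exact IsUniformBigO.clm_apply (f := fun ζ ω => (fun i j => R ζ ω i j : Fin n → Fin n → ℂ))
      (IsUniformBigO.pi fun i => IsUniformBigO.pi fun j => hRdecay α α' i j)
      (conjMulVec v).toContinuousLinearMap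

theorem equivFun_mulVec_of_eigenbasis {A : Matrix (Fin n) (Fin n) ℂ}
    {v : Module.Basis (Fin n) ℂ (Fin n → ℂ)} {ν : Fin n → ℂ} (hA : ∀ j, A.mulVec (v j) = ν j • v j)
    (y : Fin n → ℂ) (k : Fin n) : v.equivFun (A.mulVec y) k = ν k * v.equivFun y k := by
  have h1 : A.mulVec y = ∑ j, (v.equivFun y j * ν j) • v j := by
    conv_lhs => rw [← v.sum_equivFun y]
    rw [← Matrix.mulVecLin_apply, map_sum]
    refine Finset.sum_congr rfl fun j _ => ?_
    rw [map_smul, Matrix.mulVecLin_apply, hA, smul_smul]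
  rw [h1, ← v.equivFun_symm_apply, LinearEquiv.apply_symm_apply, mul_comm]

/-- The chain rule multiplies the coefficient by z, and the eigenbasis diagonalises A. The inverse
coordinate map gives the converse. -/
theorem isSolution_iff {M : ℝ} {A : Matrix (Fin n) (Fin n) ℂ}
    {v : Module.Basis (Fin n) ℂ (Fin n → ℂ)} {ν : Fin n → ℂ} (hA : ∀ j, A.mulVec (v j) = ν j • v j)
    {R : PuncturedCover → ℂ → Matrix (Fin n) (Fin n) ℂ} {ω : ℂ} {ψ : PuncturedCover → Fin n → ℂ} :
    IsSolution M (coefficient A H β c R ω) ψ ↔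
      IsReducedSolution M (fun k => -ν k) (fun ζ ω => proj ζ * leading H β c ζ ω)
        (fun ζ ω => conjMulVec v (R ζ ω)) ω (fun ζ => v.equivFun (ψ ζ)) := by
  refine forall₂_congr fun ζ _ => ?_
  rw [hasZDerivAt_iff]
  have h1 : v.equivFun (proj ζ • (coefficient A H β c R ω ζ).mulVec (ψ ζ)) =
      reducedCoefficient (fun k => -ν k) (fun ζ ω => proj ζ * leading H β c ζ ω)
        (fun ζ ω => conjMulVec v (R ζ ω)) ζ ω (v.equivFun (ψ ζ)) := by
    ext k
    rw [reducedCoefficient_apply, conjMulVec_apply, LinearEquiv.symm_apply_apply, coefficient,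
      Matrix.add_mulVec, Matrix.neg_mulVec, Matrix.smul_mulVec, map_smul, map_add, map_neg,
      map_smul]
    simp only [Pi.smul_apply, Pi.add_apply, Pi.neg_apply, smul_eq_mul,
      equivFun_mulVec_of_eigenbasis hA, proj]
    ring
  rw [← h1]
  constructor
  · intro h
    exact v.equivFunL.toContinuousLinearMap.hasFDerivAt.comp_hasDerivAt ζ h
  · intro h
    have h2 := v.equivFunL.symm.toContinuousLinearMap.hasFDerivAt.comp_hasDerivAt ζ h
    convert! h2 using 1
    · ext1 w
      exact (v.equivFun.symm_apply_apply (ψ w)).symm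
    · exact (v.equivFun.symm_apply_apply _).symm

/-- On |z| > M the error term is determined by ψ: it is exp(μP) ψ minus the eigenvector. Linear
coordinate changes preserve uniform bounds up to a constant. -/
theorem hasAsymptotics_iff {M α α' δ : ℝ} {v : Module.Basis (Fin n) ℂ (Fin n → ℂ)} {μ : ℂ}
    {P : ℂ → ℂ → ℂ} {j : Fin n} {ψ : PuncturedCover → ℂ → Fin n → ℂ} :
    HasAsymptotics M Ω α α' δ (v j) (fun ζ ω => μ * P ζ ω) ψ ↔
      HasLeadingTerm Ω P δ α α' μ (Pi.single j 1) (fun ζ ω => v.equivFun (ψ ζ ω)) := by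
  have hvj : v.equivFun (v j) = Pi.single j 1 := by
    ext k
    simp [Pi.single_apply, eq_comm]
  constructor
  · rintro ⟨ε, hε, h⟩
    refine IsUniformBigO.congr_outer (M := M)
      (IsUniformBigO.clm_apply hε v.equivFunL.toContinuousLinearMap) fun ζ hζ ω hω => ?_
    change Complex.exp (μ * P ζ ω) • v.equivFun (ψ ζ ω) - _ = v.equivFun (ε ζ ω)
    rw [h ζ hζ ω hω, map_smul, smul_smul, ← Complex.exp_add, add_neg_cancel, Complex.exp_zero,
      one_smul, map_add, hvj, add_sub_cancel_left]
  · intro h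
    refine ⟨_, IsUniformBigO.clm_apply h v.equivFunL.symm.toContinuousLinearMap,
      fun ζ _ ω _ => ?_⟩
    have h1 : v.equivFunL.symm.toContinuousLinearMap
        (Complex.exp (μ * P ζ ω) • v.equivFun (ψ ζ ω) - Pi.single j 1) =
        Complex.exp (μ * P ζ ω) • ψ ζ ω - v j := by
      change v.equivFun.symm _ = _
      rw [map_sub, map_smul, LinearEquiv.symm_apply_apply, ← hvj, LinearEquiv.symm_apply_apply]
    rw [h1, add_sub_cancel, smul_smul, ← Complex.exp_add, neg_add_cancel, Complex.exp_zero,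
      one_smul]

end Translation

theorem mainTheorem8
    {n : ℕ} (M : ℝ) (hM : 0 < M)
    (Ω : Set ℂ) (hΩo : IsOpen Ω) (hΩc : IsConnected Ω)
    -- diagonalisable `A`, with a basis of eigenvectors `v j` and eigenvalues `ν j`
    (A : Matrix (Fin n) (Fin n) ℂ) (v : Module.Basis (Fin n) ℂ (Fin n → ℂ)) (ν : Fin n → ℂ)
    (hA : ∀ j, A.mulVec (v j) = ν j • v j)
    -- exponents `β 0 > β 1 > ... > β H = -1` and coefficients `c 1, ..., c H`
    (H : ℕ) (hH : 1 ≤ H) (β : ℕ → ℝ) (hβ : StrictAntiOn β (Set.Iic H)) (hβH : β H = -1)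
    (c : ℕ → ℂ → ℂ)
    (hc : ∀ k ∈ Finset.Icc 1 H, DifferentiableOn ℂ (c k) Ω ∧ ∃ B : ℝ, ∀ ω ∈ Ω, ‖c k ω‖ ≤ B)
    (R : PuncturedCover → ℂ → Matrix (Fin n) (Fin n) ℂ) (δ : ℝ) (hδ : 0 < δ)
    (hRhol : ∀ i j, PuncturedCover.IsHolomorphic M Ω (fun ζ ω => R ζ ω i j))
    (hRdecay : ∀ α α' : ℝ, ∀ i j,
      PuncturedCover.IsUniformBigO Ω α α' (-1 - δ) (fun ζ ω => R ζ ω i j)) :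
    (∀ a b : ℝ, a ≤ b →
      (∀ τ ∈ Set.Icc a b, ∀ j j' : Fin n,
        ((ν j - ν j') * Complex.exp (Complex.I * τ)).re = 0 ↔ ν j = ν j') →
      ∃ Y : Fin n → PuncturedCover → ℂ → Fin n → ℂ,
        (∀ ω ∈ Ω, PuncturedCover.IsSolutionBasis M (PuncturedCover.coefficient A H β c R ω)
          (fun j ζ => Y j ζ ω)) ∧
        (∀ j, PuncturedCover.IsHolomorphic M Ω (Y j)) ∧
        (∀ j, PuncturedCover.HasAsymptotics M Ω (a / (β 0 + 1)) ((b + Real.pi) / (β 0 + 1)) δ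
          (v j) (fun ζ ω => ν j * PuncturedCover.primitive H β c ζ ω) (Y j)) ∧
        ∀ Y' : Fin n → PuncturedCover → ℂ → Fin n → ℂ,
          (∀ ω ∈ Ω, ∀ j, PuncturedCover.IsSolution M (PuncturedCover.coefficient A H β c R ω)
            (fun ζ => Y' j ζ ω)) →
          (∀ j, PuncturedCover.HasAsymptotics M Ω (a / (β 0 + 1)) ((b + Real.pi) / (β 0 + 1)) δ
            (v j) (fun ζ ω => ν j * PuncturedCover.primitive H β c ζ ω) (Y' j)) →
          ∀ j, ∀ ζ ∈ PuncturedCover.outer M, ∀ ω ∈ Ω, Y' j ζ ω = Y j ζ ω) ∧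
    (∀ (a b : ℝ) (j₀ : Fin n), a ≤ b →
      (∀ τ ∈ Set.Icc a b, ∀ j : Fin n, j ≠ j₀ →
        0 < ((ν j₀ - ν j) * Complex.exp (Complex.I * τ)).re) →
      ∃ Ψ : PuncturedCover → ℂ → Fin n → ℂ,
        (∀ ω ∈ Ω, PuncturedCover.IsSolution M (PuncturedCover.coefficient A H β c R ω)
          (fun ζ => Ψ ζ ω)) ∧
        PuncturedCover.IsHolomorphic M Ω Ψ ∧
        PuncturedCover.HasAsymptotics M Ω ((a - Real.pi) / (β 0 + 1))
          ((b + Real.pi) / (β 0 + 1)) δ (v j₀)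
          (fun ζ ω => ν j₀ * PuncturedCover.primitive H β c ζ ω) Ψ ∧
        ∀ Ψ' : PuncturedCover → ℂ → Fin n → ℂ,
          (∀ ω ∈ Ω, PuncturedCover.IsSolution M (PuncturedCover.coefficient A H β c R ω)
            (fun ζ => Ψ' ζ ω)) →
          PuncturedCover.HasAsymptotics M Ω ((a - Real.pi) / (β 0 + 1))
            ((b + Real.pi) / (β 0 + 1)) δ (v j₀)
            (fun ζ ω => ν j₀ * PuncturedCover.primitive H β c ζ ω) Ψ' →
          ∀ ζ ∈ PuncturedCover.outer M, ∀ ω ∈ Ω, Ψ' ζ ω = Ψ ζ ω) := by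
  have hκ : 0 < β 0 + 1 := by
    have := hβ (Set.mem_Iic.2 (Nat.zero_le H)) (Set.mem_Iic.2 le_rfl) hH
    rw [hβH] at this
    linarith
  have hπ := Real.pi_pos
  have hP := isPhase_primitive hH hβ hβH hc
  have hR := isDecaying_conjMulVec v hRhol hRdecay
  have hback : ∀ y : ℂ → ℂ → Fin n → ℂ, PuncturedCover.IsHolomorphic M Ω y →
      PuncturedCover.IsHolomorphic M Ω (fun ζ ω => v.equivFun.symm (y ζ ω)) := fun y hy =>
    v.equivFunL.symm.toContinuousLinearMap.differentiable.comp_differentiableOn hy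
  refine ⟨fun a b hab hν => ?_, fun a b j₀ hab hν => ?_⟩
  · obtain ⟨Y, hYd, hY, hYO⟩ := exists_leading_family hM hκ hδ hΩo hP hR hab hν
    have hle : a / (β 0 + 1) ≤ (b + Real.pi) / (β 0 + 1) := by gcongr; linarith
    refine ⟨fun j ζ ω => v.equivFun.symm (Y j ζ ω), fun ω hω => ⟨fun j => ?_, fun φ hφ => ?_⟩,
      fun j => hback _ (hYd j), fun j => ?_, fun Y' hY' hYO' j ζ hζ ω hω => ?_⟩
    · rw [isSolution_iff hA]
      simpa only [LinearEquiv.apply_symm_apply] using hY ω hω j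
    · rw [isSolution_iff hA] at hφ
      obtain ⟨x, hx, hxu⟩ := existsUnique_coefficients hM hω hP hR (Y := fun j ζ => Y j ζ ω)
        (hY ω hω) (fun j => PuncturedCover.IsUniformBigO.tendsto_ray hδ (hYO j) hω le_rfl hle) hφ
      have hiff : ∀ x : Fin n → ℂ, ∀ ζ, φ ζ = ∑ j, x j • v.equivFun.symm (Y j ζ ω) ↔
          v.equivFun (φ ζ) = ∑ j, x j • Y j ζ ω := by
        intro x ζ
        rw [← LinearEquiv.eq_symm_apply, map_sum]
        simp only [map_smul]
      exact ⟨x, fun ζ hζ => (hiff x ζ).2 (hx ζ hζ),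
        fun x' hx' => hxu x' fun ζ hζ => (hiff x' ζ).1 (hx' ζ hζ)⟩
    · rw [hasAsymptotics_iff]
      simpa only [LinearEquiv.apply_symm_apply] using hYO j
    · rw [LinearEquiv.eq_symm_apply]
      -- Uniqueness is tested on the two edges of the sector, where κ arg z equals a and b + π.
      refine eq_of_two_rays (θ := a / (β 0 + 1)) (θ' := (b + Real.pi) / (β 0 + 1)) hM hδ hP hR hω
        (hY ω hω) (Y₂ := fun j ζ ω => v.equivFun (Y' j ζ ω))
        (fun j => (isSolution_iff hA).1 (hY' ω hω j)) hYO
        (fun j => hasAsymptotics_iff.1 (hYO' j)) ⟨le_rfl, hle⟩ ⟨le_rfl, hle⟩ ⟨hle, le_rfl⟩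
        ⟨hle, le_rfl⟩ (fun j k => ?_) j hζ
      rw [mul_div_cancel₀ _ hκ.ne', mul_div_cancel₀ _ hκ.ne']
      exact IsSeparating.subdominant hν ⟨le_rfl, hab⟩ ⟨hab, le_rfl⟩ j k
  · have hν' : ∀ τ ∈ Set.Icc a b, ∀ k, ν j₀ - ν k = 0 ∨
        0 < ((ν j₀ - ν k) * Complex.exp (Complex.I * τ)).re := by
      intro τ hτ k
      rcases eq_or_ne k j₀ with rfl | hk
      · exact Or.inl (sub_self _)
      · exact Or.inr (hν τ hτ k hk)
    obtain ⟨y, hyd, hy, hyO⟩ := exists_subdominant_solution hM hκ hδ hΩo hP hR hab j₀ hν'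
    have hmem : a / (β 0 + 1) ∈
        Set.Icc ((a - Real.pi) / (β 0 + 1)) ((b + Real.pi) / (β 0 + 1)) :=
      ⟨by gcongr; linarith, by gcongr; linarith⟩
    refine ⟨fun ζ ω => v.equivFun.symm (y ζ ω), fun ω hω => ?_, hback _ hyd, ?_,
      fun Ψ' hΨ' hΨO' ζ hζ ω hω => ?_⟩
    · rw [isSolution_iff hA]
      simpa only [LinearEquiv.apply_symm_apply] using hy ω hω
    · rw [hasAsymptotics_iff]
      simpa only [LinearEquiv.apply_symm_apply] using hyO
    · rw [LinearEquiv.eq_symm_apply]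
      -- One ray suffices for uniqueness here; any direction of [a, b] would do.
      refine eq_of_subdominant_ray (θ := a / (β 0 + 1)) hM hδ hP hR hω
        (y₁ := fun ζ ω => v.equivFun (Ψ' ζ ω)) ((isSolution_iff hA).1 (hΨ' ω hω)) (hy ω hω)
        (hasAsymptotics_iff.1 hΨO') hyO hmem hmem (fun k => ?_) hζ
      rw [mul_div_cancel₀ _ hκ.ne']
      exact hν' a ⟨le_rfl, hab⟩ k
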